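/- Let $[n]=\{1<\dots<n\}$. A right (resp. left) string data structure $\mathbb S=(D,I,R)$ over $[n]$ is a set $D$ with a distinguished element $\emptyset$, an insertion map $I:D\times[n]\to D$ and an injective reading map $R:D\to[n]^*$ with $R(\emptyset)=\lambda$ (the empty word) and $R(I(\emptyset,x))=x$ for all $x\in[n]$, such that $C_{\mathbb S}(R(d))=d$ for all $d\in D$, where $C_{\mathbb S}(w)$ is obtained from $\emptyset$ by inserting the letters of $w$ from left to right (resp. from right to left), and such that the product on $D$ which inserts in this way the word $R(d')$ into $d$ is associative. A morphism $\mathbb S\to\mathbb S'$ of right (resp. left) string data structures is a map $f:D\to D'$ with $f(\emptyset)=\emptyset'$, $f(I(d,x))=I'(f(d),x)$ and $C_{\mathbb S'}(R(d))=C_{\mathbb S'}(R'(f(d)))$ for all $d\in D$, $x\in[n]$. A diagonal skew tableau over $[n]$ is a (possibly empty) sequence of nonempty columns, strictly increasing from top to bottom, such that the top box of each column is immediately to the left of the bottom box of the next one and is weakly smaller than it; $\mathrm{dSk}_n$ is the set of these, and $\mathrm{Yt}_n$ is the set of (semistandard) Young tableaux over $[n]$. Both are read column by column from left to right, each column from bottom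 to top; every word over $[n]$ is the reading of a unique diagonal skew tableau. Let $\mathrm{dSKrow}_n$ be $\mathrm{dSk}_n$ with the insertion that puts $x$ on top of the last column if $x$ is strictly smaller than its top entry, and otherwise adds a new last column with the single entry $x$; let $\mathrm{dSKcol}_n$ be $\mathrm{dSk}_n$ with the insertion that puts $x$ at the bottom of the first column if $x$ is strictly larger than its bottom entry, and otherwise adds a new first column with the single entry $x$. Let $\mathrm{Yrow}_n$ and $\mathrm{Ycol}_n$ be $\mathrm{Yt}_n$ with Schensted's row insertion and column insertion respectively. Theorem. $\mathrm{dSKrow}_n$ and $\mathrm{Yrow}_n$ are right string data structures, and $\mathrm{dSKcol}_n$ and $\mathrm{Ycol}_n$ are left string data structures. For every diagonal skew tableau $d$, every sequence of forward slidings of the jeu de taquin that starts from $d$ terminates, and all the maximal ones end, whatever the choices of inner corners are, with the same Young tableau $\mathrm{rect}(d)$. The map $\mathrm{rect}:\mathrm{dSk}_n\to\mathrm{Yt}_n$ is surjective, and it is a morphism of string data structures $\mathrm{dSKrow}_n\to\mathrm{Yrow}_n$ as well as $\mathrm{dSKcol}_n\to\mathrm{Ycol}_n$. Moreover: 1. $\mathrm{rect}(d)=C_{\mathrm{Yrow}_n}(R(d))=C_{\mathrm{Ycol}_n}(R(d))$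 for every diagonal skew tableau $d$; 2. each forward sliding of a tableau that is obtained by forward slidings from a diagonal skew tableau preserves the class of the reading in the plactic congruence, which is generated by the Knuth relations $zxy=xzy$ for $x\le y<z$ and $yzx=yxz$ for $x<y\le z$; 3. diagonal skew tableaux with plactic congruent readings have the same rectification. -/

import Mathlib

namespace JdT

/-! ## String data structures over `[n]`, with `[n]` realised as `Fin n` -/

/-- The underlying data `(D, ∅, I, R)` of a string data structure over `[n]`. The laws are the
predicates `IsRightSDS` and `IsLeftSDS` below. -/
structure SDSData (n : ℕ) where
  /-- the underlying set `D` -/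
  D : Type
  /-- the distinguished element `∅` -/
  empty : D
  /-- the insertion map `I : D × [n] → D` -/
  ins : D → Fin n → D
  /-- the reading map `R : D → [n]^*` -/
  read : D → List (Fin n)

namespace SDSData

variable {n : ℕ} (S : SDSData n)

/-- Right insertion of a word, letter by letter, starting with its leftmost letter. -/
def insWordRight (d : S.D) (u : List (Fin n)) : S.D := u.foldl S.ins d

/-- Left insertion of a word, letter by letter, starting with its rightmost letter. -/
def insWordLeft (u : List (Fin n)) (d : S.D) : S.D := u.foldr (fun x e => S.ins e x) d

/-- The constructor of a right string data structure. -/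
def constrRight (u : List (Fin n)) : S.D := S.insWordRight S.empty u

/-- The constructor of a left string data structure. -/
def constrLeft (u : List (Fin n)) : S.D := S.insWordLeft u S.empty

/-- The product on `D` given by right insertion of readings. -/
def starRight (d d' : S.D) : S.D := S.insWordRight d (S.read d')

/-- The product on `D` given by left insertion of readings. -/
def starLeft (d d' : S.D) : S.D := S.insWordLeft (S.read d') d

end SDSData

/-- The laws of an (associative) right string data structure. -/
structure IsRightSDS {n : ℕ} (S : SDSData n) : Prop where
  read_single : ∀ x, S.read (S.ins S.empty x) = [x]
  constr_read : ∀ d, S.constrRight (S.read d) = d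
  read_injective : Function.Injective S.read
  read_empty : S.read S.empty = []
  assoc : ∀ d₁ d₂ d₃, S.starRight (S.starRight d₁ d₂) d₃ = S.starRight d₁ (S.starRight d₂ d₃)

/-- The laws of an (associative) left string data structure. -/
structure IsLeftSDS {n : ℕ} (S : SDSData n) : Prop where
  read_single : ∀ x, S.read (S.ins S.empty x) = [x]
  constr_read : ∀ d, S.constrLeft (S.read d) = d
  read_injective : Function.Injective S.read
  read_empty : S.read S.empty = []
  assoc : ∀ d₁ d₂ d₃, S.starLeft (S.starLeft d₁ d₂) d₃ = S.starLeft d₁ (S.starLeft d₂ d₃)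

/-- `f` is a morphism of right string data structures. -/
structure IsRightMorphism {n : ℕ} (S S' : SDSData n) (f : S.D → S'.D) : Prop where
  map_empty : f S.empty = S'.empty
  map_ins : ∀ d x, f (S.ins d x) = S'.ins (f d) x
  constr_read : ∀ d, S'.constrRight (S.read d) = S'.constrRight (S'.read (f d))

/-- `f` is a morphism of left string data structures. -/
structure IsLeftMorphism {n : ℕ} (S S' : SDSData n) (f : S.D → S'.D) : Prop where
  map_empty : f S.empty = S'.empty
  map_ins : ∀ d x, f (S.ins d x) = S'.ins (f d) x
  constr_read : ∀ d, S'.constrLeft (S.read d) = S'.constrLeft (S'.read (f d))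

/-! ## The plactic congruence -/

/-- One application of a Knuth relation inside a word. -/
inductive KnuthStep {n : ℕ} : List (Fin n) → List (Fin n) → Prop
  | zxy (u v : List (Fin n)) (x y z : Fin n) : x ≤ y → y < z →
      KnuthStep (u ++ [z, x, y] ++ v) (u ++ [x, z, y] ++ v)
  | yzx (u v : List (Fin n)) (x y z : Fin n) : x < y → y ≤ z →
      KnuthStep (u ++ [y, z, x] ++ v) (u ++ [y, x, z] ++ v)

/-- The plactic congruence: the congruence on `[n]^*` generated by the Knuth relations. -/
def PlacticEq {n : ℕ} : List (Fin n) → List (Fin n) → Prop := Relation.EqvGen KnuthStep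

/-! ## Strings of columns

A column is listed from top to bottom. A string of columns whose gluing sequence is given by a
gluing map `g` is the list of its (nonempty) columns, from left to right: consecutive columns
`c`, `c'` are glued so that the first `g c c'` boxes of `c` are to the left of the last `g c c'`
boxes of `c'`. -/

/-- Two columns can follow each other in a skew tableau with gluing map `g`: at least one row is
full, the top (bottom) of `u` is not above the top (bottom) of `v`, and the full rows are weakly
increasing. -/
def Glued {n : ℕ} (g : List (Fin n) → List (Fin n) → ℕ) (u v : List (Fin n)) : Prop :=
  1 ≤ g u v ∧ g u v ≤ u.length ∧ g u v ≤ v.length ∧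
    ∀ j x y, u[j]? = some x → v[v.length - g u v + j]? = some y → x ≤ y

/-- Skew tableaux over `[n]` whose gluing sequence is given by the gluing map `g`. -/
def IsTableau {n : ℕ} (g : List (Fin n) → List (Fin n) → ℕ) (w : List (List (Fin n))) : Prop :=
  (∀ c ∈ w, c ≠ [] ∧ c.Pairwise (· < ·)) ∧ w.IsChain (Glued g)

/-- The gluing map of diagonal skew tableaux. -/
def diagGlue {n : ℕ} : List (Fin n) → List (Fin n) → ℕ := fun _ _ => 1

/-- The gluing map of Young tableaux. -/
def youngGlue {n : ℕ} : List (Fin n) → List (Fin n) → ℕ := fun _ c' => c'.length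

/-- The set of diagonal skew tableaux over `[n]`. -/
def DSkew (n : ℕ) : Type := {w : List (List (Fin n)) // IsTableau diagGlue w}

/-- The set of Young tableaux over `[n]`. -/
def Young (n : ℕ) : Type := {w : List (List (Fin n)) // IsTableau youngGlue w}

/-- The south-west reading: columns from left to right, each one from bottom to top. -/
def readSW {n : ℕ} (w : List (List (Fin n))) : List (Fin n) := w.flatMap List.reverse

/-! ## Jeu de taquin -/

/-- A filling of the quarter plane: box `(i, j)` is in row `i` (from top to bottom) and column `j`
(from left to right), and `none` is an empty box. -/
abbrev Filling (n : ℕ) : Type := ℕ × ℕ → Option (Fin n)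

/-- The row of the top box of the first column, when the top box of the last column is in
row `0`. -/
def topRow {n : ℕ} (g : List (Fin n) → List (Fin n) → ℕ) : List (List (Fin n)) → ℕ
  | [] => 0
  | [_] => 0
  | c :: c' :: w => topRow g (c' :: w) + (c'.length - g c c')

/-- The filling that a tableau with gluing map `g` gives. -/
def filling {n : ℕ} (g : List (Fin n) → List (Fin n) → ℕ) : List (List (Fin n)) → Filling n
  | [], _ => none
  | u :: w, (i, 0) => if topRow g (u :: w) ≤ i then u[i - topRow g (u :: w)]? else none
  | _ :: w, (i, j + 1) => filling g w (i, j)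

/-- The filling of a diagonal skew tableau. -/
def DSkew.filling {n : ℕ} (d : DSkew n) : Filling n := JdT.filling diagGlue d.1

/-- The filling of a Young tableau. -/
def Young.filling {n : ℕ} (t : Young n) : Filling n := JdT.filling youngGlue t.1

/-- For a filling of a skew shape `λ / μ`: the box `b` is in `μ` (with `λ` the smallest partition
that contains all the nonempty boxes). -/
def IsInnerBox {n : ℕ} (T : Filling n) (b : ℕ × ℕ) : Prop :=
  T b = none ∧ ∃ b', b.1 ≤ b'.1 ∧ b.2 ≤ b'.2 ∧ T b' ≠ none

/-- `b` is an inner corner, that is, a corner of `μ`: for row connected shapes this means that `b`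
is empty and that the boxes below and to the right of `b` are nonempty. -/
def IsInnerCorner {n : ℕ} (T : Filling n) (b : ℕ × ℕ) : Prop :=
  IsInnerBox T b ∧ ¬ IsInnerBox T (b.1 + 1, b.2) ∧ ¬ IsInnerBox T (b.1, b.2 + 1)

/-- Move the entry of box `b'` to box `b`, so that `b'` becomes empty. -/
def moveBox {n : ℕ} (T : Filling n) (b' b : ℕ × ℕ) : Filling n :=
  Function.update (Function.update T b (T b')) b' none

/-- The elementary slidings, for a filling with a marked empty box `(i, j)`: either the entry below
moves up or the entry to the right moves left. -/
inductive SlideStep {n : ℕ} : Filling n × (ℕ × ℕ) → Filling n × (ℕ × ℕ) → Prop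
  | up (T : Filling n) (i j : ℕ) (x : Fin n) : T (i + 1, j) = some x →
      (∀ y, T (i, j + 1) = some y → x ≤ y) →
      SlideStep (T, (i, j)) (moveBox T (i + 1, j) (i, j), (i + 1, j))
  | left (T : Filling n) (i j : ℕ) (x : Fin n) : T (i, j + 1) = some x →
      (∀ y, T (i + 1, j) = some y → x < y) →
      SlideStep (T, (i, j)) (moveBox T (i, j + 1) (i, j), (i, j + 1))

/-- A forward sliding: starting from an inner corner, the empty box moves until the boxes below it
and to its right are empty. -/
def ForwardSlide {n : ℕ} (T T' : Filling n) : Prop :=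
  ∃ b b' : ℕ × ℕ, IsInnerCorner T b ∧ Relation.ReflTransGen SlideStep (T, b) (T', b') ∧
    T' (b'.1 + 1, b'.2) = none ∧ T' (b'.1, b'.2 + 1) = none

/-- `T'` is obtained from `T` by the jeu de taquin: successive forward slidings until there is no
inner corner any more. -/
def IsRectification {n : ℕ} (T T' : Filling n) : Prop :=
  Relation.ReflTransGen ForwardSlide T T' ∧ ∀ b, ¬ IsInnerCorner T' b

/-- The south-west reading of the boxes `(i, j)` with `i, j < N` of a filling. -/
def readFilling {n : ℕ} (N : ℕ) (T : Filling n) : List (Fin n) :=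
  (List.range N).flatMap fun j => (List.range N).reverse.filterMap fun i => T (i, j)

/-! ## Top and bottom concatenation on diagonal skew tableaux -/

/-- Top concatenation of `x` in the last column. -/
def topConcat {n : ℕ} : List (List (Fin n)) → Fin n → List (List (Fin n))
  | [], x => [[x]]
  | [[]], x => [[x]]
  | [a :: c], x => if a ≤ x then [a :: c, [x]] else [x :: a :: c]
  | c :: c' :: w, x => c :: topConcat (c' :: w) x

/-- Bottom concatenation of `x` in the first column. -/
def bottomConcat {n : ℕ} : List (List (Fin n)) → Fin n → List (List (Fin n))
  | [], x => [[x]]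
  | c :: w, x => if ∀ a ∈ c.getLast?, a < x then (c ++ [x]) :: w else [x] :: c :: w

/-! ## Schensted's algorithms on Young tableaux -/

/-- Insertion of `x` in a line `l` (a row or a column): the first entry `y` with `r x y` is replaced
by `x` and bumped; if there is none then `x` is added at the end. -/
def bump {α : Type*} (r : α → α → Prop) [DecidableRel r] (x : α) : List α → List α × Option α
  | [] => ([x], none)
  | a :: l => if r x a then (x :: l, some a) else (a :: (bump r x l).1, (bump r x l).2)

/-- Successive insertion of the bumped entries in a list of lines. -/
def insLines {α : Type*} (r : α → α → Prop) [DecidableRel r] : α → List (List α) → List (List α)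
  | x, [] => [[x]]
  | x, l :: t =>
    match bump r x l with
    | (l', none) => l' :: t
    | (l', some y) => l' :: insLines r y t

/-- Put the column `c` to the left of a tableau given by the list of its rows. -/
def consColumn {α : Type*} : List α → List (List α) → List (List α)
  | [], R => R
  | a :: c, [] => [a] :: consColumn c []
  | a :: c, r :: R => (a :: r) :: consColumn c R

/-- The list of the rows of a tableau given by the list of its columns, and conversely. -/
def transp {α : Type*} (t : List (List α)) : List (List α) := t.foldr consColumn []

/-- Schensted's left algorithm: `x` is inserted in the first column, and the bumped entries are
inserted in the following columns. -/
def leftSchensted {n : ℕ} (t : List (List (Fin n))) (x : Fin n) : List (List (Fin n)) :=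
  insLines (· ≤ ·) x t

/-- Schensted's right algorithm: `x` is inserted in the first row, and the bumped entries are
inserted in the following rows. -/
def rightSchensted {n : ℕ} (t : List (List (Fin n))) (x : Fin n) : List (List (Fin n)) :=
  transp (insLines (· < ·) x (transp t))

/-! ## The insertion maps preserve diagonal skew tableaux and Young tableaux -/

section Closure

theorem glued_diag_iff {n : ℕ} {c c' : List (Fin n)} (hc : c ≠ []) (hc' : c' ≠ []) :
    Glued diagGlue c c' ↔ ∀ x ∈ c.head?, ∀ y ∈ c'.getLast?, x ≤ y := by
  have h1 := List.length_pos_iff.2 hc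
  have h2 := List.length_pos_iff.2 hc'
  unfold Glued diagGlue
  constructor
  · rintro ⟨-, -, -, h⟩ x hx y hy
    refine h 0 x y ?_ ?_
    · rw [← List.head?_eq_getElem?]; exact hx
    · rw [Nat.add_zero, ← List.getLast?_eq_getElem?]; exact hy
  · intro h
    refine ⟨le_rfl, h1, h2, ?_⟩
    intro j x y hx hy
    have hj : j = 0 := by
      obtain ⟨hlt, -⟩ := List.getElem?_eq_some_iff.1 hy
      omega
    subst hj
    refine h x ?_ y ?_
    · rw [List.head?_eq_getElem?]; exact hx
    · rw [List.getLast?_eq_getElem?]; simpa using hy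

theorem isTableau_topConcat {n : ℕ} (w : List (List (Fin n))) (x : Fin n)
    (h : IsTableau diagGlue w) :
    IsTableau diagGlue (topConcat w x) ∧
      ∀ c ∈ w.head?, ∃ c' ∈ (topConcat w x).head?, c'.getLast? = c.getLast? := by
  induction w with
  | nil => simp [topConcat, IsTableau]
  | cons c w ih =>
    obtain ⟨h1, h2⟩ := h
    obtain ⟨hc, hcs⟩ := h1 c (by simp)
    cases w with
    | nil =>
      cases c with
      | nil => exact absurd rfl hc
      | cons a c =>
        unfold topConcat
        split_ifs with hax
        · refine ⟨⟨?_, ?_⟩, ?_⟩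
          · intro d hd
            simp only [List.mem_cons, List.not_mem_nil, or_false] at hd
            rcases hd with rfl | rfl
            · exact ⟨hc, hcs⟩
            · simp
          · simp only [List.isChain_cons_cons, List.isChain_singleton, and_true]
            rw [glued_diag_iff (by simp) (by simp)]
            simpa using hax
          · simp
        · refine ⟨⟨?_, by simp⟩, ?_⟩
          · intro d hd
            simp only [List.mem_cons, List.not_mem_nil, or_false] at hd
            subst hd
            refine ⟨by simp, ?_⟩
            rw [List.pairwise_cons]
            refine ⟨?_, hcs⟩
            intro b hb
            rw [List.mem_cons] at hb
            rcases hb with rfl | hb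
            · exact not_le.1 hax
            · exact (not_le.1 hax).trans ((List.pairwise_cons.1 hcs).1 b hb)
          · simp [List.getLast?_cons]
    | cons d w =>
      rw [List.isChain_cons_cons] at h2
      obtain ⟨ih1, ih2⟩ := ih ⟨fun e he => h1 e (List.mem_cons_of_mem _ he), h2.2⟩
      obtain ⟨d', hd', hl⟩ := ih2 d (by simp)
      have heq : topConcat (c :: d :: w) x = c :: topConcat (d :: w) x := by
        cases c with
        | nil => exact absurd rfl hc
        | cons a c => simp [topConcat]
      rw [heq]
      obtain ⟨t, ht⟩ : ∃ t, topConcat (d :: w) x = d' :: t := by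
        cases h' : topConcat (d :: w) x with
        | nil => rw [h'] at hd'; simp at hd'
        | cons e t => rw [h'] at hd'; simp at hd'; exact ⟨t, by rw [hd']⟩
      rw [ht] at ih1 ⊢
      refine ⟨⟨?_, ?_⟩, by simp⟩
      · intro e he
        rw [List.mem_cons] at he
        rcases he with rfl | he
        · exact ⟨hc, hcs⟩
        · exact ih1.1 e he
      · rw [List.isChain_cons_cons]
        refine ⟨?_, ih1.2⟩
        have hd0 := (h1 d (by simp)).1
        rw [glued_diag_iff hc (ih1.1 d' (by simp)).1, hl]
        exact (glued_diag_iff hc hd0).1 h2.1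

theorem isTableau_bottomConcat {n : ℕ} (w : List (List (Fin n))) (x : Fin n)
    (h : IsTableau diagGlue w) : IsTableau diagGlue (bottomConcat w x) := by
  cases w with
  | nil => simp [bottomConcat, IsTableau]
  | cons c w =>
    obtain ⟨h1, h2⟩ := h
    obtain ⟨hc, hcs⟩ := h1 c (by simp)
    simp only [bottomConcat]
    split_ifs with hx
    · constructor
      · intro d hd
        rw [List.mem_cons] at hd
        rcases hd with rfl | hd
        · refine ⟨by simp, ?_⟩
          rw [List.pairwise_append]
          refine ⟨hcs, by simp, ?_⟩
          intro a ha b hb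
          rw [List.mem_singleton] at hb
          subst hb
          have hlast := hx (c.getLast hc) (by simp [List.getLast?_eq_some_getLast hc])
          rw [← List.dropLast_append_getLast hc, List.pairwise_append] at hcs
          rw [← List.dropLast_append_getLast hc, List.mem_append] at ha
          rcases ha with ha | ha
          · exact (hcs.2.2 a ha _ (by simp)).trans hlast
          · rw [List.mem_singleton] at ha
            rw [ha]; exact hlast
        · exact h1 d (by simp [hd])
      · cases w with
        | nil => simp
        | cons d w =>
          rw [List.isChain_cons_cons] at h2 ⊢
          refine ⟨?_, h2.2⟩
          have hd0 := (h1 d (by simp)).1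
          rw [glued_diag_iff (by simp) hd0]
          have := (glued_diag_iff hc hd0).1 h2.1
          cases c with
          | nil => exact absurd rfl hc
          | cons a c => simpa using this
    · constructor
      · intro d hd
        rw [List.mem_cons] at hd
        rcases hd with rfl | hd
        · simp
        · exact h1 d hd
      · rw [List.isChain_cons_cons]
        refine ⟨?_, h2⟩
        rw [glued_diag_iff (by simp) hc]
        push Not at hx
        obtain ⟨a, ha, hax⟩ := hx
        intro y hy b hb
        simp only [List.head?_cons, Option.mem_def, Option.some.injEq] at hy
        subst hy
        rw [Option.mem_unique hb ha]
        exact hax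

variable {α : Type*}

/-- Position by position comparison of a line with a following line, which is not longer. -/
inductive Dom (Q : α → α → Prop) : List α → List α → Prop
  | nil (l : List α) : Dom Q l []
  | cons {a b : α} {l m : List α} : Q a b → Dom Q l m → Dom Q (a :: l) (b :: m)

theorem dom_iff {Q : α → α → Prop} {u v : List α} :
    Dom Q u v ↔ v.length ≤ u.length ∧
      ∀ (j : ℕ) (x y : α), u[j]? = some x → v[j]? = some y → Q x y := by
  constructor
  · intro h
    induction h with
    | nil l => simp
    | cons hab _ ih =>
      refine ⟨by simpa using ih.1, ?_⟩
      intro j x y hx hy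
      cases j with
      | zero => simp at hx hy; subst hx hy; exact hab
      | succ j => exact ih.2 j x y (by simpa using hx) (by simpa using hy)
  · induction u generalizing v with
    | nil =>
      rintro ⟨h, -⟩
      have : v = [] := by simpa using h
      subst this
      exact Dom.nil _
    | cons a u ih =>
      rintro ⟨h1, h2⟩
      cases v with
      | nil => exact Dom.nil _
      | cons b v =>
        refine Dom.cons (h2 0 a b rfl rfl) (ih ⟨by simpa using h1, ?_⟩)
        intro j x y hx hy
        exact h2 (j + 1) x y (by simpa using hx) (by simpa using hy)

/-- Tableaux as lists of lines, with relations `P` along lines and `Q` across lines. -/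
def IsLines (P Q : α → α → Prop) (t : List (List α)) : Prop :=
  (∀ l ∈ t, l ≠ [] ∧ l.Pairwise P) ∧ t.IsChain (Dom Q)

theorem isTableau_young_iff {n : ℕ} {w : List (List (Fin n))} :
    IsTableau youngGlue w ↔ IsLines (· < ·) (· ≤ ·) w := by
  unfold IsTableau IsLines
  refine and_congr_right fun h => ?_
  induction w with
  | nil => simp
  | cons c w ih =>
    cases w with
    | nil => simp
    | cons d w =>
      rw [List.isChain_cons_cons, List.isChain_cons_cons,
        ih fun e he => h e (List.mem_cons_of_mem _ he)]
      refine and_congr_left fun _ => ?_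
      have hd := List.length_pos_iff.2 (h d (by simp)).1
      rw [dom_iff]
      unfold Glued youngGlue
      simp only [Nat.sub_self, Nat.zero_add, le_refl, true_and]
      exact ⟨fun hh => hh.2, fun hh => ⟨hd, hh⟩⟩

section Bump

variable {P Q : α → α → Prop} [DecidableRel Q]

theorem mem_bump {x z : α} {l : List α} (h : z ∈ (bump Q x l).1) : z = x ∨ z ∈ l := by
  induction l with
  | nil => simpa [bump] using h
  | cons a l ih =>
    unfold bump at h
    split_ifs at h
    · rcases List.mem_cons.1 h with h | h
      · exact Or.inl h
      · exact Or.inr (List.mem_cons_of_mem _ h)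
    · rcases List.mem_cons.1 h with h | h
      · exact Or.inr (by simp [h])
      · rcases ih h with h | h
        · exact Or.inl h
        · exact Or.inr (List.mem_cons_of_mem _ h)

theorem rel_bumped {x y : α} {l : List α} (h : (bump Q x l).2 = some y) : Q x y := by
  induction l with
  | nil => simp [bump] at h
  | cons a l ih =>
    unfold bump at h
    split_ifs at h with hxa
    · simp only [Option.some.injEq] at h
      exact h ▸ hxa
    · exact ih h

theorem bump_ne_nil (x : α) (l : List α) : (bump Q x l).1 ≠ [] := by
  cases l with
  | nil => simp [bump]
  | cons a l => unfold bump; split_ifs <;> simp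

theorem pairwise_bump (h1 : ∀ a b, ¬ Q a b → P b a) (h2 : ∀ x a b, Q x a → P a b → P x b)
    {x : α} {l : List α} (h : l.Pairwise P) : (bump Q x l).1.Pairwise P := by
  induction l with
  | nil => simp [bump]
  | cons a l ih =>
    rw [List.pairwise_cons] at h
    unfold bump
    split_ifs with hxa
    · exact List.pairwise_cons.2 ⟨fun b hb => h2 _ _ _ hxa (h.1 b hb), h.2⟩
    · refine List.pairwise_cons.2 ⟨fun b hb => ?_, ih h.2⟩
      rcases mem_bump hb with rfl | hb
      · exact h1 _ _ hxa
      · exact h.1 b hb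

theorem dom_bump_left (h4 : ∀ a b c, Q a b → Q b c → Q a c) {x : α} {c d : List α}
    (h : Dom Q c d) : Dom Q (bump Q x c).1 d := by
  induction h with
  | nil l => exact Dom.nil _
  | cons hab hd ih =>
    unfold bump
    split_ifs with hxa
    · exact Dom.cons (h4 _ _ _ hxa hab) hd
    · exact Dom.cons hab ih

theorem dom_bump_bump (h1 : ∀ a b, ¬ Q a b → P b a) (h3 : ∀ a x y, P a x → Q x y → Q a y)
    (h4 : ∀ a b c, Q a b → Q b c → Q a c) {x y : α} {c d : List α} (h : Dom Q c d)
    (hy : (bump Q x c).2 = some y) : Dom Q (bump Q x c).1 (bump Q y d).1 := by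
  induction c generalizing d with
  | nil => simp [bump] at hy
  | cons a c ih =>
    by_cases hxa : Q x a
    · simp only [bump, hxa, if_true, Option.some.injEq] at hy ⊢
      subst hy
      cases h with
      | nil => exact Dom.cons hxa (Dom.nil _)
      | cons hab hd => simp only [bump, hab, if_true]; exact Dom.cons hxa hd
    · simp only [bump, hxa, if_false] at hy ⊢
      have hay : Q a y := h3 _ _ _ (h1 _ _ hxa) (rel_bumped hy)
      cases h with
      | nil => exact Dom.cons hay (Dom.nil _)
      | @cons _ b _ d hab hd =>
        by_cases hyb : Q y b
        · simp only [bump, hyb, if_true]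
          exact Dom.cons hay (dom_bump_left h4 hd)
        · simp only [bump, hyb, if_false]
          exact Dom.cons hab (ih hd hy)

theorem isLines_insLines (h1 : ∀ a b, ¬ Q a b → P b a) (h2 : ∀ x a b, Q x a → P a b → P x b)
    (h3 : ∀ a x y, P a x → Q x y → Q a y) (h4 : ∀ a b c, Q a b → Q b c → Q a c)
    {t : List (List α)} (h : IsLines P Q t) (x : α) :
    IsLines P Q (insLines Q x t) ∧
      (insLines Q x t).head? = some (bump Q x (t.head?.getD [])).1 := by
  induction t generalizing x with
  | nil => simp [insLines, bump, IsLines]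
  | cons l t ih =>
    obtain ⟨hl, hch⟩ := h
    have hl0 := hl l (by simp)
    have ht : IsLines P Q t := ⟨fun m hm => hl m (List.mem_cons_of_mem _ hm), hch.tail⟩
    have hb : (bump Q x l).1 ≠ [] ∧ (bump Q x l).1.Pairwise P :=
      ⟨bump_ne_nil x l, pairwise_bump h1 h2 hl0.2⟩
    unfold insLines
    rcases hbl : bump Q x l with ⟨l', _ | y⟩
    · rw [hbl] at hb
      refine ⟨⟨?_, ?_⟩, by simp [hbl]⟩
      · intro m hm
        rcases List.mem_cons.1 hm with rfl | hm
        · exact hb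
        · exact ht.1 m hm
      · cases t with
        | nil => simp
        | cons d t =>
          rw [List.isChain_cons_cons] at hch ⊢
          have := dom_bump_left (x := x) h4 hch.1
          rw [hbl] at this
          exact ⟨this, hch.2⟩
    · rw [hbl] at hb
      obtain ⟨ih1, ih2⟩ := ih ht y
      refine ⟨⟨?_, ?_⟩, by simp [hbl]⟩
      · intro m hm
        rcases List.mem_cons.1 hm with rfl | hm
        · exact hb
        · exact ih1.1 m hm
      · have hdom : Dom Q l (t.head?.getD []) := by
          cases t with
          | nil => exact Dom.nil _
          | cons d t => exact (List.isChain_cons_cons.1 hch).1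
        have hdom' := dom_bump_bump (x := x) (y := y) h1 h3 h4 hdom (by rw [hbl])
        rw [hbl] at hdom'
        show List.IsChain _ (l' :: insLines Q y t)
        cases hins : insLines Q y t with
        | nil => simp
        | cons e s =>
          rw [hins] at ih1 ih2
          simp only [List.head?_cons, Option.some.injEq] at ih2
          rw [List.isChain_cons_cons]
          exact ⟨ih2 ▸ hdom', ih1.2⟩

end Bump

section Transp

variable {P Q : α → α → Prop}

/-- The entries of `c` are related to all the entries of the rows on their right. -/
inductive RowDom (Q : α → α → Prop) : List α → List (List α) → Prop
  | nil (c : List α) : RowDom Q c []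
  | cons {a : α} {r c : List α} {R : List (List α)} : (∀ b ∈ r, Q a b) → RowDom Q c R →
      RowDom Q (a :: c) (r :: R)

theorem rowDom_consColumn (h4 : ∀ a b c, Q a b → Q b c → Q a c) {c d : List α}
    {R : List (List α)} (h : Dom Q c d) (hR : RowDom Q d R) : RowDom Q c (consColumn d R) := by
  induction h generalizing R with
  | nil l =>
    cases hR
    exact RowDom.nil _
  | cons hab _ ih =>
    cases hR with
    | nil =>
      refine RowDom.cons ?_ (ih (RowDom.nil _))
      simpa using hab
    | cons hbr hR =>
      refine RowDom.cons ?_ (ih hR)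
      intro z hz
      rcases List.mem_cons.1 hz with rfl | hz
      · exact hab
      · exact h4 _ _ _ hab (hbr z hz)

theorem isLines_consColumn {c : List α} {R : List (List α)} (hc : c.Pairwise P)
    (hR : IsLines Q P R) (hd : RowDom Q c R) :
    IsLines Q P (consColumn c R) ∧
      (consColumn c R).head? = c.head?.map fun a => a :: R.head?.getD [] := by
  induction c generalizing R with
  | nil =>
    cases hd
    simp [consColumn, IsLines]
  | cons a c ih =>
    rw [List.pairwise_cons] at hc
    have key : ∀ (r : List α) (R' : List (List α)), r.Pairwise Q → (∀ b ∈ r, Q a b) →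
        IsLines Q P R' → RowDom Q c R' → Dom P r (R'.head?.getD []) →
        IsLines Q P ((a :: r) :: consColumn c R') := by
      intro r R' hr har hR' hd' hrR
      obtain ⟨ih1, ih2⟩ := ih hc.2 hR' hd'
      refine ⟨?_, ?_⟩
      · intro m hm
        rcases List.mem_cons.1 hm with rfl | hm
        · exact ⟨by simp, List.pairwise_cons.2 ⟨har, hr⟩⟩
        · exact ih1.1 m hm
      · cases hcc : consColumn c R' with
        | nil => simp
        | cons e s =>
          rw [hcc] at ih1 ih2
          rw [List.isChain_cons_cons]
          refine ⟨?_, ih1.2⟩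
          cases c with
          | nil => simp at ih2
          | cons a' c =>
            simp only [List.head?_cons, Option.map_some, Option.some.injEq] at ih2
            rw [ih2]
            exact Dom.cons (hc.1 a' (by simp)) hrR
    cases hd with
    | nil =>
      refine ⟨key [] [] (by simp) (by simp) hR (RowDom.nil _) (Dom.nil _), by simp [consColumn]⟩
    | @cons _ r _ R har hd =>
      refine ⟨key r R (hR.1 r (by simp)).2 har
        ⟨fun m hm => hR.1 m (List.mem_cons_of_mem _ hm), hR.2.tail⟩ hd ?_, by simp [consColumn]⟩
      cases R with
      | nil => exact Dom.nil _
      | cons r' R => exact (List.isChain_cons_cons.1 hR.2).1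

theorem isLines_transp (h4 : ∀ a b c, Q a b → Q b c → Q a c) {t : List (List α)}
    (h : IsLines P Q t) : IsLines Q P (transp t) := by
  suffices hs : IsLines Q P (transp t) ∧ ∀ c, Dom Q c (t.head?.getD []) → RowDom Q c (transp t) from
    hs.1
  induction t with
  | nil => exact ⟨by simp [transp, IsLines], fun c _ => RowDom.nil c⟩
  | cons d t ih =>
    obtain ⟨hl, hch⟩ := h
    obtain ⟨ih1, ih2⟩ := ih ⟨fun m hm => hl m (List.mem_cons_of_mem _ hm), hch.tail⟩
    have hdt : RowDom Q d (transp t) := by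
      refine ih2 d ?_
      cases t with
      | nil => exact Dom.nil _
      | cons e t => exact (List.isChain_cons_cons.1 hch).1
    exact ⟨(isLines_consColumn (hl d (by simp)).2 ih1 hdt).1,
      fun c hc => rowDom_consColumn h4 (by simpa using hc) hdt⟩

end Transp

theorem isTableau_leftSchensted {n : ℕ} (t : List (List (Fin n))) (x : Fin n)
    (h : IsTableau youngGlue t) : IsTableau youngGlue (leftSchensted t x) := by
  rw [isTableau_young_iff] at h ⊢
  exact (isLines_insLines (P := fun a b : Fin n => a < b) (Q := fun a b : Fin n => a ≤ b)
    (fun _ _ hab => not_le.1 hab) (fun _ _ _ => lt_of_le_of_lt)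
    (fun _ _ _ hax hxy => hax.le.trans hxy) (fun _ _ _ => le_trans) h x).1

theorem isTableau_rightSchensted {n : ℕ} (t : List (List (Fin n))) (x : Fin n)
    (h : IsTableau youngGlue t) : IsTableau youngGlue (rightSchensted t x) := by
  rw [isTableau_young_iff] at h ⊢
  refine isLines_transp (P := fun a b : Fin n => a ≤ b) (Q := fun a b : Fin n => a < b)
    (fun _ _ _ => lt_trans) ?_
  exact (isLines_insLines (P := fun a b : Fin n => a ≤ b) (Q := fun a b : Fin n => a < b)
    (fun _ _ hab => not_lt.1 hab)
    (fun _ _ _ hxa hab => hxa.le.trans hab) (fun _ _ _ => lt_of_le_of_lt)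
    (fun _ _ _ => lt_trans) (isLines_transp (P := fun a b : Fin n => a < b)
      (Q := fun a b : Fin n => a ≤ b) (fun _ _ _ => le_trans) h) x).1

end Closure

/-! ## The four string data structures -/

theorem isTableau_nil {n : ℕ} (g : List (Fin n) → List (Fin n) → ℕ) : IsTableau g [] := by
  simp [IsTableau]

/-- Diagonal skew tableaux with top concatenation (right structure). -/
def dSKrow (n : ℕ) : SDSData n where
  D := DSkew n
  empty := ⟨[], isTableau_nil _⟩
  ins d x := ⟨topConcat d.1 x, (isTableau_topConcat d.1 x d.2).1⟩
  read d := readSW d.1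

/-- Diagonal skew tableaux with bottom concatenation (left structure). -/
def dSKcol (n : ℕ) : SDSData n where
  D := DSkew n
  empty := ⟨[], isTableau_nil _⟩
  ins d x := ⟨bottomConcat d.1 x, isTableau_bottomConcat d.1 x d.2⟩
  read d := readSW d.1

/-- Young tableaux with Schensted's right insertion (right structure). -/
def Yrow (n : ℕ) : SDSData n where
  D := Young n
  empty := ⟨[], isTableau_nil _⟩
  ins t x := ⟨rightSchensted t.1 x, isTableau_rightSchensted t.1 x t.2⟩
  read t := readSW t.1

/-- Young tableaux with Schensted's left insertion (left structure). -/
def Ycol (n : ℕ) : SDSData n where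
  D := Young n
  empty := ⟨[], isTableau_nil _⟩
  ins t x := ⟨leftSchensted t.1 x, isTableau_leftSchensted t.1 x t.2⟩
  read t := readSW t.1

end JdT

open JdT

/-!
# Rectification of diagonal skew tableaux

Everything rests on the fact that a plactic class contains the column reading of exactly one Young
tableau, so that the tableau `P(w)` of a word `w` can be recognised from its reading alone.

Existence comes from Schensted's left insertion: bumping in one column is a plactic identity
(`plactic_bump_column`), hence `w` is congruent to the reading of the tableau that left insertion
builds from it (`plactic_foldr_insLines`). For uniqueness, left insertion of the two sides of a
Knuth relation in a column gives the same column, and bumps words that are equal or again the two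
sides of a Knuth relation (`bumpWord_knuthTriple`); by induction on the columns congruent words give the same
tableau (`foldr_insLines_congr`), and left insertion of the reading of a tableau gives this tableau
back (`foldr_insLines_readSW`). Right insertion is treated through rows: bumping in a row is a
plactic identity, and the row and column readings of a Young tableau are congruent
(`plactic_rowWord_transp`), so right insertion of `x` multiplies the reading by `x` in the plactic
monoid. Therefore both constructors of Young tableaux equal `P`, and associativity of the two
products is associativity of concatenation. For diagonal skew tableaux the reading is a bijection
onto the words, and the two insertions add a letter at an end of the reading.

For the jeu de taquin, a shape is skew exactly when it is order convex, and during a sliding the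
shape together with the hole stays convex. A vertical elementary sliding does not change the column
reading, and a horizontal one changes it by a plactic congruence: this only involves two columns
(`plactic_slide_columns`) and is proved by induction on the rows above the hole. Each elementary
sliding decreases the sum of the coordinates of the nonempty boxes, so the process terminates. A
skew filling without inner corner is a Young tableau (`exists_young_filling_eq`), and its reading is
congruent to the one of the initial tableau `d`; so it is `P` of the reading of `d`, whatever the
choices of inner corners are. That the map `rectification` so obtained is a morphism is then a
computation in the plactic monoid.
-/

namespace JdT

variable {n : ℕ}

/-! ### The plactic congruence -/

namespace PlacticEq

theorem refl (u : List (Fin n)) : PlacticEq u u := Relation.EqvGen.refl u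

theorem symm {u v : List (Fin n)} (h : PlacticEq u v) : PlacticEq v u := Relation.EqvGen.symm _ _ h

theorem trans {u v w : List (Fin n)} (h : PlacticEq u v) (h' : PlacticEq v w) : PlacticEq u w :=
  Relation.EqvGen.trans _ _ _ h h'

instance : Trans (PlacticEq (n := n)) PlacticEq PlacticEq := ⟨trans⟩

theorem of_eq {u v : List (Fin n)} (h : u = v) : PlacticEq u v := h ▸ refl u

theorem zxy {x y z : Fin n} (h : x ≤ y) (h' : y < z) : PlacticEq [z, x, y] [x, z, y] :=
  Relation.EqvGen.rel _ _ (KnuthStep.zxy [] [] x y z h h')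

theorem yzx {x y z : Fin n} (h : x < y) (h' : y ≤ z) : PlacticEq [y, z, x] [y, x, z] :=
  Relation.EqvGen.rel _ _ (KnuthStep.yzx [] [] x y z h h')

theorem context {u v : List (Fin n)} (p q : List (Fin n)) (h : PlacticEq u v) :
    PlacticEq (p ++ u ++ q) (p ++ v ++ q) := by
  induction h with
  | rel u v h =>
    refine Relation.EqvGen.rel _ _ ?_
    cases h with
    | zxy a b x y z h h' => simpa using KnuthStep.zxy (p ++ a) (b ++ q) x y z h h'
    | yzx a b x y z h h' => simpa using KnuthStep.yzx (p ++ a) (b ++ q) x y z h h'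
  | refl u => exact refl _
  | symm u v _ ih => exact ih.symm
  | trans u v w _ _ ih ih' => exact ih.trans ih'

theorem append {u v u' v' : List (Fin n)} (h : PlacticEq u v) (h' : PlacticEq u' v') :
    PlacticEq (u ++ u') (v ++ v') := by
  have h1 := h.context [] u'
  have h2 := h'.context v []
  simp only [List.nil_append, List.append_nil] at h1 h2
  exact h1.trans h2

theorem append_left {u v : List (Fin n)} (p : List (Fin n)) (h : PlacticEq u v) :
    PlacticEq (p ++ u) (p ++ v) := (refl p).append h

theorem append_right {u v : List (Fin n)} (q : List (Fin n)) (h : PlacticEq u v) :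
    PlacticEq (u ++ q) (v ++ q) := h.append (refl q)

theorem flatMap {ι : Type*} {f g : ι → List (Fin n)} {l : List ι}
    (h : ∀ i ∈ l, PlacticEq (f i) (g i)) : PlacticEq (l.flatMap f) (l.flatMap g) := by
  induction l with
  | nil => exact refl _
  | cons i l ih =>
    rw [List.flatMap_cons, List.flatMap_cons]
    exact (h i (by simp)).append (ih fun j hj => h j (List.mem_cons_of_mem _ hj))

end PlacticEq

/-- A letter moves through the reading of a column if a letter between it and the column
follows. -/
theorem plactic_cons_column {a b : Fin n} {v : List (Fin n)} (hv : v.Pairwise (· < ·))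
    (hab : a ≤ b) (hb : ∀ z ∈ v, b < z) :
    PlacticEq ([a] ++ v.reverse ++ [b]) (v.reverse ++ [a] ++ [b]) := by
  induction v generalizing b with
  | nil => exact PlacticEq.refl _
  | cons c v ih =>
    rw [List.pairwise_cons] at hv
    have hbc := hb c (by simp)
    have h1 := (ih hv.2 (hab.trans hbc.le) hv.1).append_right [b]
    have h2 := ((PlacticEq.zxy hab hbc).symm).append_left v.reverse
    simp only [List.reverse_cons, List.append_assoc, List.cons_append, List.nil_append] at *
    exact h1.trans h2

/-- A letter that is smaller than a column `u` moves through the reading of the column `v` to the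
right of `u`. -/
theorem plactic_column_append {u v : List (Fin n)} (h : Dom (· ≤ ·) u v)
    (hu : u.Pairwise (· < ·)) (hv : v.Pairwise (· < ·)) {a : Fin n} (ha : ∀ y ∈ u.head?, a < y) :
    PlacticEq (u.reverse ++ v.reverse ++ [a]) (u.reverse ++ [a] ++ v.reverse) := by
  induction h generalizing a with
  | nil l => simpa using PlacticEq.refl _
  | @cons b c u v hbc _ ih =>
    rw [List.pairwise_cons] at hu hv
    have hab : a < b := ha b (by simp)
    have hub : ∀ y ∈ u.head?, b < y := fun y hy => hu.1 y (List.mem_of_head? hy)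
    have h1 := (ih hu.2 hv.2 hub).symm
    have e1 := h1.append_right ([c] ++ [a])
    have e2 := (PlacticEq.yzx hab hbc).append_left (u.reverse ++ v.reverse)
    have e3 := h1.symm.append_right ([a] ++ [c])
    have e4 := ((plactic_cons_column hv.2 (hab.le.trans hbc) hv.1).symm).append_left
      (u.reverse ++ [b])
    simp only [List.reverse_cons, List.append_assoc, List.cons_append, List.nil_append] at *
    exact ((e1.trans e2).trans e3).trans e4

/-! ### Readings of segments of columns -/

/-- The entries, from top to bottom, of the column `f` in the rows `k, …, k + m - 1`;
empty boxes are skipped. -/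
def colSeg {α : Type*} (f : ℕ → Option α) (k m : ℕ) : List α := (List.range' k m).filterMap f

section ColSeg

variable {α : Type*} {f g : ℕ → Option α}

theorem colSeg_zero (f : ℕ → Option α) (k : ℕ) : colSeg f k 0 = [] := rfl

theorem colSeg_succ (f : ℕ → Option α) (k m : ℕ) :
    colSeg f k (m + 1) = (f k).toList ++ colSeg f (k + 1) m := by
  unfold colSeg
  rw [List.range'_succ, List.filterMap_cons]
  cases f k <;> rfl

theorem colSeg_add (f : ℕ → Option α) (k m m' : ℕ) :
    colSeg f k (m + m') = colSeg f k m ++ colSeg f (k + m) m' := by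
  unfold colSeg
  rw [← List.filterMap_append, List.range'_append_1]

theorem mem_colSeg {k m : ℕ} {y : α} :
    y ∈ colSeg f k m ↔ ∃ r, k ≤ r ∧ r < k + m ∧ f r = some y := by
  unfold colSeg
  simp only [List.mem_filterMap, List.mem_range'_1, and_assoc]

theorem colSeg_congr {k m : ℕ} (h : ∀ r, k ≤ r → r < k + m → f r = g r) :
    colSeg f k m = colSeg g k m := by
  unfold colSeg
  refine List.filterMap_congr fun r hr => ?_
  rw [List.mem_range'_1] at hr
  exact h r hr.1 hr.2

theorem colSeg_eq_nil {k m : ℕ} (h : ∀ r, k ≤ r → r < k + m → f r = none) :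
    colSeg f k m = [] := by
  rw [List.eq_nil_iff_forall_not_mem]
  intro y hy
  obtain ⟨r, h1, h2, h3⟩ := mem_colSeg.1 hy
  rw [h r h1 h2] at h3
  cases h3

theorem pairwise_colSeg {R : α → α → Prop} {k m : ℕ}
    (h : ∀ r s x y, k ≤ r → r < s → s < k + m → f r = some x → f s = some y → R x y) :
    (colSeg f k m).Pairwise R := by
  induction m generalizing k with
  | zero => exact List.Pairwise.nil
  | succ m ih =>
    rw [colSeg_succ]
    have ih' := ih (k := k + 1) fun r s x y h1 h2 h3 =>
      h r s x y (by omega) h2 (by omega)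
    cases hk : f k with
    | none => simpa using ih'
    | some x =>
      simp only [Option.toList_some, List.cons_append, List.nil_append, List.pairwise_cons]
      refine ⟨fun y hy => ?_, ih'⟩
      obtain ⟨s, h1, h2, h3⟩ := mem_colSeg.1 hy
      exact h k s x y le_rfl (by omega) (by omega) hk h3

/-- A column of which the entries start in row `k` dominates a shorter such column on its right. -/
theorem dom_colSeg {Q : α → α → Prop} {k m : ℕ}
    (hg : ∀ r, k ≤ r → g r = none → g (r + 1) = none)
    (h : ∀ r y, k ≤ r → r < k + m → g r = some y → ∃ x, f r = some x ∧ Q x y) :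
    Dom Q (colSeg f k m) (colSeg g k m) := by
  induction m generalizing k with
  | zero => exact Dom.nil _
  | succ m ih =>
    cases hk : g k with
    | none =>
      have hnone : ∀ r, k ≤ r → g r = none := fun r hr => Nat.le_induction hk hg r hr
      rw [colSeg_eq_nil (f := g) fun r hr _ => hnone r hr]
      exact Dom.nil _
    | some y =>
      obtain ⟨x, hx, hxy⟩ := h k y le_rfl (by omega) hk
      rw [colSeg_succ, colSeg_succ, hk, hx]
      exact Dom.cons hxy (ih (fun r hr => hg r (by omega))
        fun r y h1 h2 => h r y (by omega) (by omega))

end ColSeg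

/-- The effect of a horizontal elementary sliding on the reading of the two columns that it
involves. The parts of these columns below the sliding are `B` and `B'`, and their parts above it
are segments of `f` and `g`. -/
theorem plactic_slide_columns {B B' : List (Fin n)} {x : Fin n} (hdom : Dom (· ≤ ·) B B')
    (hB : B.Pairwise (· < ·)) (hB' : B'.Pairwise (· < ·)) (hxB : ∀ y ∈ B.head?, x < y)
    (hxB' : ∀ y ∈ B', x < y) {f g : ℕ → Option (Fin n)} {k m : ℕ}
    (hfg : ∀ r a, k ≤ r → r < k + m → f r = some a → ∃ a', g r = some a' ∧ a ≤ a')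
    (hgx : ∀ r a, k ≤ r → r < k + m → g r = some a → a < x)
    (hgg : ∀ r s a b, k ≤ r → r < s → s < k + m → g r = some a → g s = some b → a < b) :
    PlacticEq (B.reverse ++ (colSeg f k m).reverse ++ (B'.reverse ++ [x] ++ (colSeg g k m).reverse))
      (B.reverse ++ [x] ++ (colSeg f k m).reverse ++ (B'.reverse ++ (colSeg g k m).reverse)) := by
  induction m generalizing k with
  | zero => simpa [colSeg_zero] using plactic_column_append hdom hB hB' hxB
  | succ m ih =>
    have ih' := ih (k := k + 1) (fun r a h1 h2 => hfg r a (by omega) (by omega))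
      (fun r a h1 h2 => hgx r a (by omega) (by omega))
      (fun r s a b h1 h2 h3 => hgg r s a b (by omega) h2 (by omega))
    rw [colSeg_succ, colSeg_succ]
    cases hf : f k with
    | none =>
      have := ih'.append_right (g k).toList.reverse
      simpa using this
    | some a =>
      obtain ⟨a', hg, haa'⟩ := hfg k a le_rfl (by omega) hf
      rw [hg]
      have hG : (colSeg g (k + 1) m).Pairwise (· < ·) :=
        pairwise_colSeg fun r s x y h1 h2 h3 => hgg r s x y (by omega) h2 (by omega)
      have ha'G : ∀ z ∈ colSeg g (k + 1) m, a' < z := fun z hz => by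
        obtain ⟨s, h1, h2, h3⟩ := mem_colSeg.1 hz
        exact hgg k s a' z le_rfl (by omega) (by omega) hg h3
      have hGx : ∀ z ∈ colSeg g (k + 1) m, z < x := fun z hz => by
        obtain ⟨s, h1, h2, h3⟩ := mem_colSeg.1 hz
        exact hgx s z (by omega) (by omega) h3
      have ha'x := hgx k a' le_rfl (by omega) hg
      -- the top entry `a` of the left column moves next to its right neighbour `a'` and back
      have e1 := plactic_cons_column (v := colSeg g (k + 1) m ++ x :: B') (a := a) (b := a')
        (by
          rw [List.pairwise_append, List.pairwise_cons]
          refine ⟨hG, ⟨hxB', hB'⟩, fun y hy z hz => ?_⟩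
          rcases List.mem_cons.1 hz with rfl | hz
          · exact hGx y hy
          · exact (hGx y hy).trans (hxB' z hz)) haa'
        (by
          intro z hz
          rcases List.mem_append.1 hz with hz | hz
          · exact ha'G z hz
          · rcases List.mem_cons.1 hz with rfl | hz
            · exact ha'x
            · exact ha'x.trans (hxB' z hz))
      have e2 := plactic_cons_column (v := colSeg g (k + 1) m ++ B') (a := a) (b := a')
        (by
          rw [List.pairwise_append]
          exact ⟨hG, hB', fun y hy z hz => (hGx y hy).trans (hxB' z hz)⟩) haa'
        (by
          intro z hz
          rcases List.mem_append.1 hz with hz | hz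
          · exact ha'G z hz
          · exact ha'x.trans (hxB' z hz))
      have f1 := e1.append_left (B.reverse ++ (colSeg f (k + 1) m).reverse)
      have f2 := ih'.append_right [a, a']
      have f3 := e2.symm.append_left (B.reverse ++ [x] ++ (colSeg f (k + 1) m).reverse)
      simp only [Option.toList_some, List.reverse_append, List.reverse_cons,
        List.append_assoc, List.cons_append, List.nil_append] at *
      exact (f1.trans f2).trans f3

/-! ### Schensted insertion in one line -/

section Bump

variable {α : Type*} {r : α → α → Prop} [DecidableRel r]

theorem bump_eq_append {x : α} {l : List α} (h : (bump r x l).2 = none) :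
    (bump r x l).1 = l ++ [x] := by
  induction l with
  | nil => rfl
  | cons a l ih =>
    unfold bump at h ⊢
    split_ifs at h ⊢ with hxa
    simpa using ih h

theorem mem_of_bump {x y : α} {l : List α} (h : (bump r x l).2 = some y) : y ∈ l := by
  induction l with
  | nil => simp [bump] at h
  | cons a l ih =>
    unfold bump at h
    split_ifs at h with hxa
    · simp only [Option.some.injEq] at h
      simp [h]
    · exact List.mem_cons_of_mem _ (ih h)

end Bump

/-- Inserting a letter in a column, as an identity in the plactic monoid. The bound on the first
entry of the new column is what carries the induction. -/
theorem plactic_bump_column {x y : Fin n} {c : List (Fin n)} (hc : c.Pairwise (· < ·))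
    (h : (bump (· ≤ ·) x c).2 = some y) :
    PlacticEq (x :: c.reverse) ((bump (· ≤ ·) x c).1.reverse ++ [y]) ∧
      ∃ e s, (bump (· ≤ ·) x c).1 = e :: s ∧ e ≤ y := by
  induction c with
  | nil => simp [bump] at h
  | cons a c ih =>
    rw [List.pairwise_cons] at hc
    have hxy : x ≤ y := rel_bumped h
    by_cases hxa : x ≤ a
    · simp only [bump, hxa, if_true, Option.some.injEq] at h ⊢
      subst h
      refine ⟨?_, x, c, rfl, hxa⟩
      simpa using plactic_cons_column hc.2 hxa hc.1
    · simp only [bump, hxa, if_false] at h ⊢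
      have hax := not_le.1 hxa
      obtain ⟨ih1, e, s, hes, hey⟩ := ih hc.2 h
      refine ⟨?_, a, _, rfl, (hax.trans_le hxy).le⟩
      have hae : a < e := by
        rcases mem_bump (x := x) (l := c) (Q := (· ≤ ·)) (z := e) (by rw [hes]; simp) with he | he
        · exact he ▸ hax
        · exact hc.1 e he
      rw [hes] at ih1 ⊢
      have e1 := ih1.append_right [a]
      have e2 := (PlacticEq.yzx hae hey).append_left s.reverse
      simp only [List.reverse_cons, List.append_assoc, List.cons_append, List.nil_append] at *
      exact e1.trans e2

/-- A letter that is smaller than a row moves through this row up to its first letter. -/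
theorem plactic_row_append {a x : Fin n} {l : List (Fin n)} (h : (a :: l).Pairwise (· ≤ ·))
    (hx : x < a) : PlacticEq (a :: l ++ [x]) (a :: x :: l) := by
  induction l generalizing a with
  | nil => exact PlacticEq.refl _
  | cons b l ih =>
    rw [List.pairwise_cons] at h
    have hab := h.1 b (by simp)
    have e1 := (ih h.2 (hx.trans_le hab)).append_left [a]
    have e2 := (PlacticEq.yzx hx hab).append_right l
    exact e1.trans e2

/-- Inserting a letter in a row, as an identity in the plactic monoid. The bound on the first entry
of the new row is what carries the induction. -/
theorem plactic_bump_row {x y : Fin n} {l : List (Fin n)} (hl : l.Pairwise (· ≤ ·))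
    (h : (bump (· < ·) x l).2 = some y) :
    PlacticEq (l ++ [x]) (y :: (bump (· < ·) x l).1) ∧
      ∃ e s, (bump (· < ·) x l).1 = e :: s ∧ e < y := by
  induction l with
  | nil => simp [bump] at h
  | cons a l ih =>
    have hl' := hl
    rw [List.pairwise_cons] at hl
    have hxy : x < y := rel_bumped h
    by_cases hxa : x < a
    · simp only [bump, hxa, if_true, Option.some.injEq] at h ⊢
      subst h
      exact ⟨plactic_row_append hl' hxa, x, l, rfl, hxa⟩
    · simp only [bump, hxa, if_false] at h ⊢
      have hax := not_lt.1 hxa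
      obtain ⟨ih1, e, s, hes, hey⟩ := ih hl.2 h
      refine ⟨?_, a, _, rfl, hax.trans_lt hxy⟩
      have hae : a ≤ e := by
        rcases mem_bump (x := x) (l := l) (Q := (· < ·)) (z := e) (by rw [hes]; simp) with he | he
        · exact he ▸ hax
        · exact hl.1 e he
      rw [hes] at ih1 ⊢
      have e1 := ih1.append_left [a]
      have e2 := (PlacticEq.zxy hae hey).symm.append_right s
      exact e1.trans e2

/-! ### Left insertion and the plactic congruence -/

theorem readSW_cons (c : List (Fin n)) (t : List (List (Fin n))) :
    readSW (c :: t) = c.reverse ++ readSW t := by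
  simp [readSW]

theorem insLines_cons {α : Type*} {r : α → α → Prop} [DecidableRel r] (x : α) (l : List α)
    (t : List (List α)) : insLines r x (l :: t) =
      (bump r x l).1 :: ((bump r x l).2.elim t fun y => insLines r y t) := by
  rw [insLines]
  rcases bump r x l with ⟨l', _ | y⟩ <;> rfl

theorem plactic_readSW_leftSchensted (x : Fin n) {t : List (List (Fin n))}
    (ht : ∀ c ∈ t, c.Pairwise (· < ·)) :
    PlacticEq (x :: readSW t) (readSW (leftSchensted t x)) := by
  unfold leftSchensted
  induction t generalizing x with
  | nil => exact PlacticEq.refl _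
  | cons c t ih =>
    rw [insLines_cons, readSW_cons, readSW_cons]
    cases h : (bump (· ≤ ·) x c).2 with
    | none =>
      rw [bump_eq_append h]
      simpa using PlacticEq.refl _
    | some y =>
      have e1 := (plactic_bump_column (ht c (by simp)) h).1.append_right (readSW t)
      have e2 := (ih y fun d hd => ht d (List.mem_cons_of_mem _ hd)).append_left
        (bump (· ≤ ·) x c).1.reverse
      simp only [List.append_assoc, List.cons_append, List.nil_append] at e1 e2
      exact e1.trans e2

/-- The column obtained by left insertion of a word in a column, and the word of the bumped
entries, which is written from right to left so that it is left inserted in the next column in the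
right order. -/
def bumpWord : List (Fin n) → List (Fin n) → List (Fin n) × List (Fin n)
  | [], c => (c, [])
  | x :: w, c => ((bump (· ≤ ·) x (bumpWord w c).1).1,
      (bump (· ≤ ·) x (bumpWord w c).1).2.toList ++ (bumpWord w c).2)

theorem bumpWord_append_singleton (w : List (Fin n)) (x : Fin n) (c : List (Fin n)) :
    bumpWord (w ++ [x]) c = ((bumpWord w (bump (· ≤ ·) x c).1).1,
      (bumpWord w (bump (· ≤ ·) x c).1).2 ++ (bump (· ≤ ·) x c).2.toList) := by
  induction w with
  | nil => simp [bumpWord]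
  | cons y w ih => simp [bumpWord, ih]

theorem bumpWord_cons_of_lt {w : List (Fin n)} {a : Fin n} (h : ∀ x ∈ w, a < x)
    (c : List (Fin n)) : bumpWord w (a :: c) = (a :: (bumpWord w c).1, (bumpWord w c).2) := by
  induction w with
  | nil => rfl
  | cons y w ih =>
    have hy : ¬ y ≤ a := not_le.2 (h y (by simp))
    simp [bumpWord, ih fun x hx => h x (List.mem_cons_of_mem _ hx), bump, hy]

theorem foldr_insLines_cons (w c : List (Fin n)) (t : List (List (Fin n))) :
    w.foldr (insLines (· ≤ ·)) (c :: t) =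
      (bumpWord w c).1 :: (bumpWord w c).2.foldr (insLines (· ≤ ·)) t := by
  induction w with
  | nil => rfl
  | cons x w ih =>
    rw [List.foldr_cons, ih, insLines_cons, bumpWord]
    cases (bump (· ≤ ·) x (bumpWord w c).1).2 <;> rfl

/-- The two Knuth relations, without context. -/
inductive KnuthTriple : List (Fin n) → List (Fin n) → Prop
  | zxy {x y z : Fin n} : x ≤ y → y < z → KnuthTriple [z, x, y] [x, z, y]
  | yzx {x y z : Fin n} : x < y → y ≤ z → KnuthTriple [y, z, x] [y, x, z]

/-- Letters inserted in increasing order bump increasing entries; if the second one bumps an entry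
then so does the first one. -/
theorem lt_of_bump_bump {y z z' : Fin n} {c : List (Fin n)} (hc : c.Pairwise (· < ·)) (hyz : y < z)
    (h : (bump (· ≤ ·) z (bump (· ≤ ·) y c).1).2 = some z') :
    ∃ y', (bump (· ≤ ·) y c).2 = some y' ∧ y' < z' := by
  induction c with
  | nil => simp [bump, not_le.2 hyz] at h
  | cons a c ih =>
    rw [List.pairwise_cons] at hc
    by_cases hya : y ≤ a
    · simp only [bump, hya, if_true, not_le.2 hyz, if_false] at h ⊢
      exact ⟨a, rfl, hc.1 _ (mem_of_bump h)⟩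
    · have hza : ¬ z ≤ a := not_le.2 ((not_le.1 hya).trans hyz)
      simp only [bump, hya, hza, if_false] at h ⊢
      exact ih hc.2 h

theorem exists_bump_bump_le {y z : Fin n} (c : List (Fin n)) (hyz : y ≤ z) :
    ∃ y', (bump (· ≤ ·) y (bump (· ≤ ·) z c).1).2 = some y' ∧ y' ≤ z := by
  induction c with
  | nil => simp [bump, hyz]
  | cons a c ih =>
    by_cases hza : z ≤ a
    · simp [bump, hza, hyz]
    · by_cases hya : y ≤ a
      · exact ⟨a, by simp [bump, hza, hya], (not_le.1 hza).le⟩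
      · simpa [bump, hza, hya] using ih

/-- Left insertion of the two sides of a Knuth relation in a column gives the same column, and
bumps equal words or the two sides of a Knuth relation. -/
theorem bumpWord_knuthTriple {w w' : List (Fin n)} (h : KnuthTriple w w') {c : List (Fin n)}
    (hc : c.Pairwise (· < ·)) :
    (bumpWord w c).1 = (bumpWord w' c).1 ∧ ((bumpWord w c).2 = (bumpWord w' c).2 ∨
      KnuthTriple (bumpWord w c).2 (bumpWord w' c).2 ∨
      KnuthTriple (bumpWord w' c).2 (bumpWord w c).2) := by
  induction c with
  | nil =>
    cases h with
    | zxy hxy hyz =>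
      simp [bumpWord, bump, hxy, not_le.2 hyz, not_le.2 (hxy.trans_lt hyz)]
    | yzx hxy hyz =>
      simp [bumpWord, bump, hyz, not_le.2 hxy, not_le.2 (hxy.trans_le hyz), (hxy.trans_le hyz).le]
  | cons a c ih =>
    rw [List.pairwise_cons] at hc
    have ih := ih hc.2
    cases h with
    | @zxy x y z hxy hyz =>
      -- all the letters pass a first entry below `x`; otherwise `x` bumps the first entry,
      -- or `y` if `y` has bumped it before
      have hxz := hxy.trans_lt hyz
      by_cases hxa : x ≤ a
      · by_cases hya : y ≤ a
        · cases hz : (bump (· ≤ ·) z c).2 with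
          | none => simp [bumpWord, bump, hya, hxy, not_le.2 hxz, not_le.2 hyz, hz]
          | some z' =>
            have := KnuthTriple.zxy hya (hc.1 z' (mem_of_bump hz))
            simp [bumpWord, bump, hya, hxy, not_le.2 hxz, not_le.2 hyz, hz, this]
        · have hza : ¬ z ≤ a := not_le.2 ((not_le.1 hya).trans hyz)
          cases hz : (bump (· ≤ ·) z (bump (· ≤ ·) y c).1).2 with
          | none => simp [bumpWord, bump, hya, hxa, hza, not_le.2 hxz, hz]
          | some z' =>
            obtain ⟨y', hy', hyz'⟩ := lt_of_bump_bump hc.2 hyz hz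
            have := KnuthTriple.zxy (((not_le.1 hya).trans_le (rel_bumped hy')).le) hyz'
            simp [bumpWord, bump, hya, hxa, hza, not_le.2 hxz, hz, hy', this]
      · have hax := not_le.1 hxa
        rw [bumpWord_cons_of_lt (by simp [hax, hax.trans_le hxy, hax.trans hxz]),
          bumpWord_cons_of_lt (by simp [hax, hax.trans_le hxy, hax.trans hxz])]
        exact ⟨by rw [ih.1], ih.2⟩
    | @yzx x y z hxy hyz =>
      have hxz := hxy.trans_le hyz
      by_cases hxa : x ≤ a
      · by_cases hza : z ≤ a
        -- if there are two entries `a < b`, then `x`, `y` end up in their place and `z`, `a`, `b`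
        -- are bumped: the bumped words form a relation of the other kind
        · cases c with
          | nil =>
            simp [bumpWord, bump, hxa, hza, not_le.2 hxz, not_le.2 hxy, hyz, hxz.le]
          | cons b c =>
            have hab := hc.1 b (by simp)
            have := KnuthTriple.zxy hza hab
            simp [bumpWord, bump, hxa, hza, not_le.2 hxz, not_le.2 hxy, hyz, hxz.le,
              hza.trans hab.le, (hyz.trans hza).trans hab.le, this]
        · obtain ⟨y', hy', hyz'⟩ := exists_bump_bump_le c hyz
          cases hz : (bump (· ≤ ·) z c).2 with
          | none => simp [bumpWord, bump, hxa, hza, not_le.2 hxz, not_le.2 hxy, hz]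
          | some z' =>
            have hay' : a < y' := by
              rcases mem_bump (mem_of_bump hy') with h | h
              · exact h ▸ not_le.1 hza
              · exact hc.1 y' h
            have := KnuthTriple.yzx hay' (hyz'.trans (rel_bumped hz))
            simp [bumpWord, bump, hxa, hza, not_le.2 hxz, not_le.2 hxy, hz, hy', this]
      · have hax := not_le.1 hxa
        rw [bumpWord_cons_of_lt (by simp [hax, hax.trans hxy, hax.trans hxz]),
          bumpWord_cons_of_lt (by simp [hax, hax.trans hxy, hax.trans hxz])]
        exact ⟨by rw [ih.1], ih.2⟩

theorem foldr_insLines_knuthTriple {w w' : List (Fin n)} (h : KnuthTriple w w')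
    {t : List (List (Fin n))} (ht : ∀ c ∈ t, c.Pairwise (· < ·)) :
    w.foldr (insLines (· ≤ ·)) t = w'.foldr (insLines (· ≤ ·)) t := by
  induction t generalizing w w' with
  | nil =>
    cases h with
    | zxy hxy hyz =>
      simp [insLines, bump, hxy, not_le.2 hyz, not_le.2 (hxy.trans_lt hyz)]
    | yzx hxy hyz =>
      simp [insLines, bump, hyz, not_le.2 hxy, not_le.2 (hxy.trans_le hyz), (hxy.trans_le hyz).le]
  | cons c t ih =>
    rw [foldr_insLines_cons, foldr_insLines_cons]
    obtain ⟨h1, h2⟩ := bumpWord_knuthTriple h (ht c (by simp))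
    have ht' : ∀ d ∈ t, d.Pairwise (· < ·) := fun d hd => ht d (List.mem_cons_of_mem _ hd)
    rw [h1]
    rcases h2 with h2 | h2 | h2
    · rw [h2]
    · rw [ih h2 ht']
    · rw [ih h2 ht']

theorem isLines_foldr_insLines (w : List (Fin n)) :
    IsLines (· < ·) (· ≤ ·) (w.foldr (insLines (· ≤ ·)) []) := by
  induction w with
  | nil => simp [IsLines]
  | cons x w ih =>
    rw [← isTableau_young_iff] at ih ⊢
    exact isTableau_leftSchensted _ x ih

/-- Knuth's theorem: plactic congruent words have the same tableau. -/
theorem foldr_insLines_congr {w w' : List (Fin n)} (h : PlacticEq w w') :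
    w.foldr (insLines (· ≤ ·)) [] = w'.foldr (insLines (· ≤ ·)) [] := by
  induction h with
  | refl => rfl
  | symm _ _ _ ih => exact ih.symm
  | trans _ _ _ _ _ ih ih' => exact ih.trans ih'
  | rel w w' h =>
    have key : ∀ u v m m' : List (Fin n), KnuthTriple m m' →
        (u ++ m ++ v).foldr (insLines (· ≤ ·)) [] = (u ++ m' ++ v).foldr (insLines (· ≤ ·)) [] := by
      intro u v m m' hm
      simp only [List.foldr_append]
      rw [foldr_insLines_knuthTriple hm]
      exact fun c hc => ((isLines_foldr_insLines v).1 c hc).2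
    cases h with
    | zxy u v x y z hxy hyz => exact key u v _ _ (KnuthTriple.zxy hxy hyz)
    | yzx u v x y z hxy hyz => exact key u v _ _ (KnuthTriple.yzx hxy hyz)

theorem plactic_foldr_insLines (w : List (Fin n)) :
    PlacticEq w (readSW (w.foldr (insLines (· ≤ ·)) [])) := by
  induction w with
  | nil => exact PlacticEq.refl _
  | cons x w ih =>
    exact (ih.append_left [x]).trans (plactic_readSW_leftSchensted x
      fun c hc => ((isLines_foldr_insLines w).1 c hc).2)

/-- Left insertion of the reading of a column `c` in a column that can follow `c` in a Young
tableau bumps the whole of this column. -/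
theorem bumpWord_reverse {c d : List (Fin n)} (h : Dom (· ≤ ·) c d) (hc : c.Pairwise (· < ·)) :
    bumpWord c.reverse d = (c, d.reverse) := by
  induction h with
  | nil c =>
    induction c with
    | nil => rfl
    | cons a c ih =>
      rw [List.pairwise_cons] at hc
      rw [List.reverse_cons, bumpWord_append_singleton, bump,
        bumpWord_cons_of_lt fun x hx => hc.1 x (List.mem_reverse.1 hx), ih hc.2]
      rfl
  | cons hab _ ih =>
    rw [List.pairwise_cons] at hc
    rw [List.reverse_cons, bumpWord_append_singleton, bump, if_pos hab,
      bumpWord_cons_of_lt fun x hx => hc.1 x (List.mem_reverse.1 hx), ih hc.2]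
    simp

theorem foldr_insLines_reverse {c : List (Fin n)} {t : List (List (Fin n))} (hc0 : c ≠ [])
    (hc : c.Pairwise (· < ·)) (ht : IsLines (· < ·) (· ≤ ·) t)
    (hd : Dom (· ≤ ·) c (t.head?.getD [])) :
    c.reverse.foldr (insLines (· ≤ ·)) t = c :: t := by
  induction t generalizing c with
  | nil =>
    have : ∀ w : List (Fin n), w ≠ [] →
        w.foldr (insLines (· ≤ ·)) [] = w.foldr (insLines (· ≤ ·)) [[]] := by
      intro w hw
      induction w with
      | nil => exact absurd rfl hw
      | cons x w ih =>
        rcases eq_or_ne w [] with rfl | hw'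
        · rfl
        · rw [List.foldr_cons, List.foldr_cons, ih hw']
    rw [this _ (by simpa using hc0), foldr_insLines_cons, bumpWord_reverse (Dom.nil c) hc]
    rfl
  | cons d t ih =>
    rw [foldr_insLines_cons, bumpWord_reverse (by simpa using hd) hc]
    obtain ⟨h1, h2⟩ := ht.1 d (by simp)
    rw [ih h1 h2 ⟨fun l hl => ht.1 l (List.mem_cons_of_mem _ hl), ht.2.tail⟩]
    cases t with
    | nil => exact Dom.nil _
    | cons e t => exact (List.isChain_cons_cons.1 ht.2).1

theorem foldr_insLines_readSW {t : List (List (Fin n))} (ht : IsLines (· < ·) (· ≤ ·) t) :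
    (readSW t).foldr (insLines (· ≤ ·)) [] = t := by
  induction t with
  | nil => rfl
  | cons c t ih =>
    have ht' : IsLines (fun a b : Fin n => a < b) (fun a b => a ≤ b) t :=
      ⟨fun l hl => ht.1 l (List.mem_cons_of_mem _ hl), ht.2.tail⟩
    rw [readSW_cons, List.foldr_append, ih ht']
    refine foldr_insLines_reverse (ht.1 c (by simp)).1 (ht.1 c (by simp)).2 ht' ?_
    cases t with
    | nil => exact Dom.nil _
    | cons e t => exact (List.isChain_cons_cons.1 ht.2).1

/-! ### Rows and columns of a Young tableau -/

section Transp

variable {α : Type*}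

theorem length_consColumn {c : List α} {R : List (List α)} (h : R.length ≤ c.length) :
    (consColumn c R).length = c.length := by
  induction c generalizing R with
  | nil => simpa [consColumn] using h
  | cons a c ih =>
    cases R with
    | nil => simp [consColumn, ih]
    | cons r R => simpa [consColumn] using ih (by simpa using h)

theorem transp_consColumn {c : List α} {R : List (List α)} (hc : c ≠ [])
    (h : R.length ≤ c.length) : transp (consColumn c R) = c :: transp R := by
  induction c generalizing R with
  | nil => exact absurd rfl hc
  | cons a c ih =>
    have key : ∀ (r : List α) (R' : List (List α)), R'.length ≤ c.length →
        transp ((a :: r) :: consColumn c R') = (a :: c) :: transp (r :: R') := by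
      intro r R' hR'
      rcases eq_or_ne c [] with rfl | hc'
      · have : R' = [] := by simpa using hR'
        subst this
        simp [transp, consColumn]
      · have := ih hc' hR'
        unfold transp at this ⊢
        rw [List.foldr_cons, this, List.foldr_cons]
        rfl
    cases R with
    | nil => exact key [] [] (by simp)
    | cons r R => exact key r R (by simpa using h)

theorem transp_transp {P Q : α → α → Prop} {t : List (List α)} (ht : IsLines P Q t) :
    transp (transp t) = t := by
  suffices h : transp (transp t) = t ∧ (transp t).length = (t.head?.getD []).length from h.1
  induction t with
  | nil => simp [transp]
  | cons c t ih =>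
    obtain ⟨ih1, ih2⟩ := ih ⟨fun l hl => ht.1 l (List.mem_cons_of_mem _ hl), ht.2.tail⟩
    have hlen : (transp t).length ≤ c.length := by
      rw [ih2]
      cases t with
      | nil => simp
      | cons d t => exact (dom_iff.1 (List.isChain_cons_cons.1 ht.2).1).1
    have htr : transp (c :: t) = consColumn c (transp t) := rfl
    rw [htr, transp_consColumn (ht.1 c (by simp)).1 hlen, ih1, length_consColumn hlen]
    exact ⟨rfl, rfl⟩

/-- The rows of a tableau are its first row, followed by the rows of what is below it. -/
theorem transp_eq_cons {t : List (List α)} (ht : ∀ c ∈ t, c ≠ []) (ht0 : t ≠ []) :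
    transp t = t.filterMap List.head? :: transp (t.map List.tail) := by
  induction t with
  | nil => exact absurd rfl ht0
  | cons c t ih =>
    obtain ⟨a, c, rfl⟩ := List.exists_cons_of_ne_nil (ht c (by simp))
    rcases eq_or_ne t [] with rfl | ht'
    · simp [transp, consColumn]
    · have := ih (fun d hd => ht d (List.mem_cons_of_mem _ hd)) ht'
      unfold transp at this ⊢
      rw [List.foldr_cons, this]
      simp [consColumn]

theorem transp_filter_ne_nil [DecidableEq α] (t : List (List α)) :
    transp (t.filter (· ≠ [])) = transp t := by
  induction t with
  | nil => rfl
  | cons c t ih =>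
    cases c with
    | nil => simpa [transp, consColumn] using ih
    | cons a c =>
      simp only [ne_eq, reduceCtorEq, not_false_eq_true, decide_true, List.filter_cons_of_pos]
      unfold transp at ih ⊢
      rw [List.foldr_cons, List.foldr_cons, ih]

end Transp

/-- The reading of the list of the rows of a tableau: from bottom to top, each row from left to
right. -/
def rowWord : List (List (Fin n)) → List (Fin n)
  | [] => []
  | r :: R => rowWord R ++ r

/-- A letter that is smaller than a Young tableau moves through all columns but the first one. -/
theorem plactic_readSW_append {u : List (Fin n)} {t : List (List (Fin n))} {a : Fin n}
    (hch : (u :: t).IsChain (Dom (· ≤ ·))) (hs : ∀ c ∈ u :: t, c.Pairwise (· < ·))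
    (ha : ∀ c ∈ u :: t, ∀ y ∈ c, a < y) :
    PlacticEq (u.reverse ++ readSW t ++ [a]) (u.reverse ++ [a] ++ readSW t) := by
  induction t generalizing u with
  | nil => simpa [readSW] using PlacticEq.refl _
  | cons v t ih =>
    rw [List.isChain_cons_cons] at hch
    have e1 := (ih hch.2 (fun c hc => hs c (List.mem_cons_of_mem _ hc))
      (fun c hc => ha c (List.mem_cons_of_mem _ hc))).append_left u.reverse
    have e2 := (plactic_column_append hch.1 (hs u (by simp)) (hs v (by simp)) (a := a)
      (fun y hy => ha u (by simp) y (List.mem_of_head? hy))).append_right (readSW t)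
    rw [readSW_cons]
    simp only [List.append_assoc] at *
    exact e1.trans e2

/-- The first row of a Young tableau can be put back on top of its other rows. -/
theorem plactic_readSW_tail {t : List (List (Fin n))} (ht : IsLines (· < ·) (· ≤ ·) t) :
    PlacticEq (readSW (t.map List.tail) ++ t.filterMap List.head?) (readSW t) := by
  induction t with
  | nil => exact PlacticEq.refl _
  | cons c t ih =>
    have ht' : IsLines (fun a b : Fin n => a < b) (fun a b => a ≤ b) t :=
      ⟨fun l hl => ht.1 l (List.mem_cons_of_mem _ hl), ht.2.tail⟩
    have ih := ih ht'
    obtain ⟨hc0, hc⟩ := ht.1 c (by simp)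
    obtain ⟨a, c, rfl⟩ := List.exists_cons_of_ne_nil hc0
    have hsorted : ∀ d ∈ (a :: c) :: t, d.tail.Pairwise (· < ·) := fun d hd =>
      (ht.1 d hd).2.sublist (List.tail_sublist d)
    have hch : (((a :: c) :: t).map List.tail).IsChain (Dom (· ≤ ·)) := by
      refine List.isChain_map_of_isChain _ (fun u v huv => ?_) ht.2
      cases huv with
      | nil => exact Dom.nil _
      | cons _ h => exact h
    have hall : ∀ d ∈ (a :: c) :: t, ∀ b ∈ d.head?, a ≤ b := by
      have htrans : ∀ (s : List (List (Fin n))) (a : Fin n) (c : List (Fin n)),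
          IsLines (· < ·) (· ≤ ·) ((a :: c) :: s) → ∀ d ∈ (a :: c) :: s, ∀ b ∈ d.head?, a ≤ b := by
        intro s
        induction s with
        | nil =>
          intro a c _ d hd b hb
          simp only [List.mem_singleton] at hd
          subst hd
          simp at hb
          exact hb.le
        | cons e s ihs =>
          intro a c hs d hd b hb
          rcases List.mem_cons.1 hd with rfl | hd
          · simp at hb
            exact hb.le
          · obtain ⟨a', e, rfl⟩ := List.exists_cons_of_ne_nil (hs.1 e (by simp)).1
            have h1 := (List.isChain_cons_cons.1 hs.2).1
            have haa' : a ≤ a' := by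
              cases h1 with
              | cons h _ => exact h
            exact haa'.trans (ihs a' e
              ⟨fun l hl => hs.1 l (List.mem_cons_of_mem _ hl), hs.2.tail⟩ d hd b hb)
      exact htrans t a c ht
    have hlt : ∀ d ∈ ((a :: c) :: t).map List.tail, ∀ y ∈ d, a < y := by
      intro d hd y hy
      obtain ⟨d', hd', rfl⟩ := List.mem_map.1 hd
      obtain ⟨hd0, hds⟩ := ht.1 d' hd'
      obtain ⟨b, d, rfl⟩ := List.exists_cons_of_ne_nil hd0
      exact (hall _ hd' b (by simp)).trans_lt ((List.pairwise_cons.1 hds).1 y hy)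
    have e1 := (plactic_readSW_append (u := c) (t := t.map List.tail) (a := a) hch
      (fun d hd => by
        obtain ⟨d', hd', rfl⟩ := List.mem_map.1 (show d ∈ ((a :: c) :: t).map List.tail from hd)
        exact hsorted d' hd') hlt).append_right (t.filterMap List.head?)
    have e2 := ih.append_left (c.reverse ++ [a])
    rw [List.map_cons, readSW_cons, readSW_cons]
    simp only [List.tail_cons, List.filterMap_cons, List.head?_cons, List.reverse_cons,
      List.append_assoc, List.cons_append, List.nil_append] at *
    exact e1.trans e2

/-- The rows are split off one by one, from the first one on; the induction is on the number of
rows, that is, on the length of the first column. -/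
theorem plactic_rowWord_transp {t : List (List (Fin n))} (ht : IsLines (· < ·) (· ≤ ·) t) :
    PlacticEq (rowWord (transp t)) (readSW t) := by
  induction hm : (t.head?.getD []).length generalizing t with
  | zero =>
    cases t with
    | nil => exact PlacticEq.refl _
    | cons c t => exact absurd (List.length_eq_zero_iff.1 (by simpa using hm)) (ht.1 c (by simp)).1
  | succ m ih =>
    have ht0 : t ≠ [] := by
      rintro rfl
      simp at hm
    rw [transp_eq_cons (fun c hc => (ht.1 c hc).1) ht0, rowWord]
    refine PlacticEq.trans (PlacticEq.append_right _ ?_) (plactic_readSW_tail ht)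
    -- the columns below the first row, without the empty ones
    have hread : ∀ s : List (List (Fin n)), readSW (s.filter (· ≠ [])) = readSW s := by
      intro s
      induction s with
      | nil => rfl
      | cons c s ihs =>
        cases c with
        | nil => simpa [readSW] using ihs
        | cons a c => simpa [readSW] using ihs
    have hch : (t.map List.tail).IsChain (Dom (· ≤ ·)) := by
      refine List.isChain_map_of_isChain _ (fun u v huv => ?_) ht.2
      cases huv with
      | nil => exact Dom.nil _
      | cons _ h => exact h
    have hfilter : ∀ s : List (List (Fin n)), s.IsChain (Dom (· ≤ ·)) →
        (s.filter (· ≠ [])).IsChain (Dom (· ≤ ·)) ∧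
          (s.filter (· ≠ [])).head?.getD [] = s.head?.getD [] := by
      intro s hs
      induction s with
      | nil => simp
      | cons c s ihs =>
        obtain ⟨i1, i2⟩ := ihs hs.tail
        have hdom : Dom (fun a b : Fin n => a ≤ b) c ((s.filter (· ≠ [])).head?.getD []) := by
          rw [i2]
          cases s with
          | nil => exact Dom.nil _
          | cons d s => exact (List.isChain_cons_cons.1 hs).1
        cases c with
        | nil =>
          generalize hd : (s.filter (· ≠ [])).head?.getD [] = d at hdom i2
          cases hdom
          have : ([] :: s).filter (fun x => decide (x ≠ [])) = s.filter (· ≠ []) := by simp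
          rw [this]
          exact ⟨i1, hd⟩
        | cons a c =>
          have : ((a :: c) :: s).filter (fun x => decide (x ≠ [])) =
              (a :: c) :: s.filter (· ≠ []) := by simp
          rw [this]
          refine ⟨?_, rfl⟩
          cases hf : s.filter (· ≠ []) with
          | nil => simp
          | cons d s' =>
            rw [hf] at hdom i1
            exact List.isChain_cons_cons.2 ⟨hdom, i1⟩
    rw [← transp_filter_ne_nil, ← hread (t.map List.tail)]
    refine ih ⟨?_, (hfilter _ hch).1⟩ ?_
    · intro l hl
      obtain ⟨hl1, hl2⟩ := List.mem_filter.1 hl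
      obtain ⟨d, hd, rfl⟩ := List.mem_map.1 hl1
      exact ⟨by simpa using hl2, (ht.1 d hd).2.sublist (List.tail_sublist d)⟩
    · rw [(hfilter _ hch).2]
      obtain ⟨c, t, rfl⟩ := List.exists_cons_of_ne_nil ht0
      simp only [List.head?_cons, Option.getD_some, List.map_cons, List.length_tail] at hm ⊢
      omega

theorem plactic_rowWord_insLines (x : Fin n) {R : List (List (Fin n))}
    (hR : ∀ r ∈ R, r.Pairwise (· ≤ ·)) :
    PlacticEq (rowWord R ++ [x]) (rowWord (insLines (· < ·) x R)) := by
  induction R generalizing x with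
  | nil => exact PlacticEq.refl _
  | cons r R ih =>
    rw [insLines_cons, rowWord, rowWord]
    cases h : (bump (· < ·) x r).2 with
    | none =>
      rw [bump_eq_append h]
      simpa using PlacticEq.refl _
    | some y =>
      have e1 := (plactic_bump_row (hR r (by simp)) h).1.append_left (rowWord R)
      have e2 := (ih y fun d hd => hR d (List.mem_cons_of_mem _ hd)).append_right
        (bump (· < ·) x r).1
      simp only [List.append_assoc, List.cons_append, List.nil_append] at e1 e2
      rw [List.append_assoc]
      exact e1.trans e2

theorem plactic_readSW_rightSchensted (x : Fin n) {t : List (List (Fin n))}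
    (ht : IsLines (· < ·) (· ≤ ·) t) :
    PlacticEq (readSW t ++ [x]) (readSW (rightSchensted t x)) := by
  have hT : IsLines (fun a b : Fin n => a ≤ b) (fun a b => a < b) (transp t) :=
    isLines_transp (P := fun a b : Fin n => a < b) (Q := fun a b : Fin n => a ≤ b)
      (fun _ _ _ => le_trans) ht
  have hT' : IsLines (fun a b : Fin n => a ≤ b) (fun a b => a < b)
      (insLines (· < ·) x (transp t)) :=
    (isLines_insLines (P := fun a b : Fin n => a ≤ b) (Q := fun a b : Fin n => a < b)
      (fun _ _ hab => not_lt.1 hab) (fun _ _ _ hxa hab => hxa.le.trans hab)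
      (fun _ _ _ => lt_of_le_of_lt) (fun _ _ _ => lt_trans) hT x).1
  have hr : IsLines (fun a b : Fin n => a < b) (fun a b => a ≤ b) (rightSchensted t x) :=
    isTableau_young_iff.1 (isTableau_rightSchensted t x (isTableau_young_iff.2 ht))
  have e1 := (plactic_rowWord_transp ht).symm.append_right [x]
  have e2 := plactic_rowWord_insLines x fun r hr => (hT.1 r hr).2
  have e3 := plactic_rowWord_transp hr
  unfold rightSchensted at e3 ⊢
  rw [transp_transp hT'] at e3
  exact (e1.trans e2).trans e3

/-! ### The string data structures of Young tableaux -/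

theorem Ycol_constrLeft_val (w : List (Fin n)) :
    ((Ycol n).constrLeft w : Young n).1 = w.foldr (insLines (· ≤ ·)) [] := by
  induction w with
  | nil => rfl
  | cons x w ih =>
    show leftSchensted ((Ycol n).constrLeft w : Young n).1 x = _
    rw [ih]
    rfl

theorem plactic_read_constrLeft (w : List (Fin n)) :
    PlacticEq w ((Ycol n).read ((Ycol n).constrLeft w)) := by
  show PlacticEq w (readSW ((Ycol n).constrLeft w : Young n).1)
  rw [Ycol_constrLeft_val]
  exact plactic_foldr_insLines w

theorem Ycol_constrLeft_read (t : (Ycol n).D) : (Ycol n).constrLeft ((Ycol n).read t) = t := by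
  refine Subtype.ext ?_
  show ((Ycol n).constrLeft (readSW t.1) : Young n).1 = t.1
  rw [Ycol_constrLeft_val, foldr_insLines_readSW (isTableau_young_iff.1 t.2)]

theorem Ycol_constrLeft_congr {w w' : List (Fin n)} (h : PlacticEq w w') :
    (Ycol n).constrLeft w = (Ycol n).constrLeft w' := by
  refine Subtype.ext ?_
  rw [Ycol_constrLeft_val, Ycol_constrLeft_val, foldr_insLines_congr h]

theorem plactic_read_insWordRight (t : (Yrow n).D) (w : List (Fin n)) :
    PlacticEq ((Yrow n).read t ++ w) ((Yrow n).read ((Yrow n).insWordRight t w)) := by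
  induction w generalizing t with
  | nil => exact PlacticEq.of_eq (List.append_nil _)
  | cons x w ih =>
    have e1 := (plactic_readSW_rightSchensted x (isTableau_young_iff.1 t.2)).append_right w
    have e2 := ih ((Yrow n).ins t x)
    rw [List.append_assoc] at e1
    exact e1.trans e2

/-- Both constructors give a tableau the reading of which is congruent to the word, and there is
only one such tableau. -/
theorem Yrow_constrRight_eq (w : List (Fin n)) :
    (Yrow n).constrRight w = (Ycol n).constrLeft w := by
  have h := Ycol_constrLeft_congr (plactic_read_insWordRight ((Yrow n).empty) w)
  exact ((Ycol_constrLeft_read _).symm.trans h.symm)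

theorem Yrow_constrRight_read (t : (Yrow n).D) : (Yrow n).constrRight ((Yrow n).read t) = t :=
  (Yrow_constrRight_eq _).trans (Ycol_constrLeft_read t)

theorem Yrow_insWordRight_eq (t : (Yrow n).D) (w : List (Fin n)) :
    (Yrow n).insWordRight t w = (Ycol n).constrLeft ((Yrow n).read t ++ w) := by
  have h := Ycol_constrLeft_congr (plactic_read_insWordRight t w)
  exact ((Ycol_constrLeft_read _).symm.trans h.symm)

theorem Ycol_insWordLeft_eq (t : (Ycol n).D) (w : List (Fin n)) :
    (Ycol n).insWordLeft w t = (Ycol n).constrLeft (w ++ (Ycol n).read t) := by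
  conv_lhs => rw [← Ycol_constrLeft_read t]
  exact (List.foldr_append).symm

theorem isRightSDS_Yrow (n : ℕ) : IsRightSDS (Yrow n) where
  read_single _ := rfl
  constr_read := Yrow_constrRight_read
  read_injective := Function.LeftInverse.injective Yrow_constrRight_read
  read_empty := rfl
  assoc a b c := by
    unfold SDSData.starRight
    refine (Yrow_insWordRight_eq _ _).trans
      ((Ycol_constrLeft_congr ?_).trans (Yrow_insWordRight_eq _ _).symm)
    have e1 := (plactic_read_insWordRight a ((Yrow n).read b)).symm.append_right ((Yrow n).read c)
    have e2 := (plactic_read_insWordRight b ((Yrow n).read c)).append_left ((Yrow n).read a)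
    rw [List.append_assoc] at e1
    exact e1.trans e2

theorem isLeftSDS_Ycol (n : ℕ) : IsLeftSDS (Ycol n) where
  read_single _ := rfl
  constr_read := Ycol_constrLeft_read
  read_injective := Function.LeftInverse.injective Ycol_constrLeft_read
  read_empty := rfl
  assoc a b c := by
    have h : ∀ (w : List (Fin n)) (t : (Ycol n).D),
        PlacticEq (w ++ (Ycol n).read t) ((Ycol n).read ((Ycol n).insWordLeft w t)) := by
      intro w t
      rw [Ycol_insWordLeft_eq]
      exact plactic_read_constrLeft _
    unfold SDSData.starLeft
    refine (Ycol_insWordLeft_eq _ _).trans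
      ((Ycol_constrLeft_congr ?_).trans (Ycol_insWordLeft_eq _ _).symm)
    have e1 := (h ((Ycol n).read b) a).symm.append_left ((Ycol n).read c)
    have e2 := (h ((Ycol n).read c) b).append_right ((Ycol n).read a)
    rw [List.append_assoc] at e2
    exact e1.trans e2

/-! ### The string data structures of diagonal skew tableaux -/

theorem readSW_topConcat {w : List (List (Fin n))} (hw : ∀ c ∈ w, c ≠ []) (x : Fin n) :
    readSW (topConcat w x) = readSW w ++ [x] := by
  induction w with
  | nil => rfl
  | cons c w ih =>
    obtain ⟨a, c, rfl⟩ := List.exists_cons_of_ne_nil (hw c (by simp))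
    cases w with
    | nil =>
      unfold topConcat
      split_ifs <;> simp [readSW]
    | cons d w =>
      have : topConcat ((a :: c) :: d :: w) x = (a :: c) :: topConcat (d :: w) x := by
        simp [topConcat]
      rw [this, readSW_cons, ih fun e he => hw e (List.mem_cons_of_mem _ he), readSW_cons (a :: c),
        List.append_assoc]

theorem readSW_bottomConcat (w : List (List (Fin n))) (x : Fin n) :
    readSW (bottomConcat w x) = x :: readSW w := by
  cases w with
  | nil => rfl
  | cons c w =>
    simp only [bottomConcat]
    split_ifs <;> simp [readSW]

theorem dSKrow_read_insWordRight (d : (dSKrow n).D) (w : List (Fin n)) :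
    (dSKrow n).read ((dSKrow n).insWordRight d w) = (dSKrow n).read d ++ w := by
  induction w generalizing d with
  | nil => simp [SDSData.insWordRight]
  | cons x w ih =>
    have h : (dSKrow n).read ((dSKrow n).ins d x) = (dSKrow n).read d ++ [x] :=
      readSW_topConcat (fun c hc => (d.2.1 c hc).1) x
    refine (ih ((dSKrow n).ins d x)).trans ?_
    rw [h, List.append_assoc]
    rfl

theorem dSKcol_read_ins (d : (dSKcol n).D) (x : Fin n) :
    (dSKcol n).read ((dSKcol n).ins d x) = x :: (dSKcol n).read d := readSW_bottomConcat d.1 x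

theorem dSKcol_read_insWordLeft (d : (dSKcol n).D) (w : List (Fin n)) :
    (dSKcol n).read ((dSKcol n).insWordLeft w d) = w ++ (dSKcol n).read d := by
  induction w with
  | nil => rfl
  | cons x w ih =>
    exact (dSKcol_read_ins _ x).trans (congrArg (x :: ·) ih)

/-- The first letter of a column opens a new first column because of the gluing condition, and the
other ones are put below it. -/
theorem foldr_bottomConcat_reverse {c : List (Fin n)} {w : List (List (Fin n))} (hc0 : c ≠ [])
    (hw : IsTableau diagGlue (c :: w)) :
    c.reverse.foldr (fun x e => bottomConcat e x) w = c :: w := by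
  obtain ⟨h1, h2⟩ := hw
  obtain ⟨-, hc⟩ := h1 c (by simp)
  induction c using List.reverseRecOn with
  | nil => exact absurd rfl hc0
  | append_singleton c x ih =>
    rw [List.reverse_concat, List.foldr_cons]
    rcases eq_or_ne c [] with rfl | hc'
    · cases w with
      | nil => rfl
      | cons d w =>
        have hd := (h1 d (by simp)).1
        have hg := (glued_diag_iff (by simp) hd).1 (List.isChain_cons_cons.1 h2).1
        have hl : ¬ ∀ a ∈ d.getLast?, a < x := by
          intro h
          have hm : d.getLast hd ∈ d.getLast? := by simp [List.getLast?_eq_some_getLast hd]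
          exact absurd (h _ hm) (not_lt.2 (hg x (by simp) _ hm))
        simp only [List.reverse_nil, List.foldr_nil, bottomConcat, if_neg hl, List.nil_append]
    · rw [List.pairwise_append] at hc
      have hs : ∀ e ∈ c :: w, e ≠ [] ∧ e.Pairwise (· < ·) := by
        intro e he
        rcases List.mem_cons.1 he with rfl | he
        · exact ⟨hc', hc.1⟩
        · exact h1 e (List.mem_cons_of_mem _ he)
      have hch : (c :: w).IsChain (Glued diagGlue) := by
        cases w with
        | nil => simp
        | cons d w =>
          rw [List.isChain_cons_cons] at h2 ⊢
          refine ⟨?_, h2.2⟩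
          have hd := (h1 d (by simp)).1
          rw [glued_diag_iff hc' hd]
          have := (glued_diag_iff (by simp) hd).1 h2.1
          cases c with
          | nil => exact absurd rfl hc'
          | cons a c => simpa using this
      rw [ih hc' hs hch hc.1]
      have : ∀ a ∈ c.getLast?, a < x := fun a ha =>
        hc.2.2 a (List.mem_of_getLast? ha) x (by simp)
      rw [bottomConcat, if_pos this]

theorem dSKcol_constrLeft_val (w : List (Fin n)) :
    ((dSKcol n).constrLeft w : DSkew n).1 = w.foldr (fun x e => bottomConcat e x) [] := by
  induction w with
  | nil => rfl
  | cons x w ih =>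
    show bottomConcat ((dSKcol n).constrLeft w : DSkew n).1 x = _
    rw [ih]
    rfl

theorem foldr_bottomConcat_readSW {w : List (List (Fin n))} (hw : IsTableau diagGlue w) :
    (readSW w).foldr (fun x e => bottomConcat e x) [] = w := by
  induction w with
  | nil => rfl
  | cons c w ih =>
    rw [readSW_cons, List.foldr_append,
      ih ⟨fun l hl => hw.1 l (List.mem_cons_of_mem _ hl), hw.2.tail⟩]
    exact foldr_bottomConcat_reverse (hw.1 c (by simp)).1 hw

theorem dSKcol_constrLeft_read (d : (dSKcol n).D) :
    (dSKcol n).constrLeft ((dSKcol n).read d) = d := by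
  refine Subtype.ext ?_
  show ((dSKcol n).constrLeft (readSW d.1) : DSkew n).1 = d.1
  rw [dSKcol_constrLeft_val, foldr_bottomConcat_readSW d.2]

theorem dSKcol_read_injective : Function.Injective (dSKcol n).read :=
  Function.LeftInverse.injective dSKcol_constrLeft_read

theorem dSKrow_read_injective : Function.Injective (dSKrow n).read := dSKcol_read_injective

theorem dSKrow_read_constrRight (w : List (Fin n)) :
    (dSKrow n).read ((dSKrow n).constrRight w) = w :=
  dSKrow_read_insWordRight (dSKrow n).empty w

theorem dSKrow_read_bijective : Function.Bijective (dSKrow n).read :=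
  ⟨dSKrow_read_injective, fun w => ⟨_, dSKrow_read_constrRight w⟩⟩

theorem isRightSDS_dSKrow (n : ℕ) : IsRightSDS (dSKrow n) where
  read_single _ := rfl
  constr_read d := dSKrow_read_injective (dSKrow_read_constrRight _)
  read_injective := dSKrow_read_injective
  read_empty := rfl
  assoc a b c := by
    apply dSKrow_read_injective
    simp only [SDSData.starRight, dSKrow_read_insWordRight, List.append_assoc]

theorem isLeftSDS_dSKcol (n : ℕ) : IsLeftSDS (dSKcol n) where
  read_single _ := rfl
  constr_read := dSKcol_constrLeft_read
  read_injective := dSKcol_read_injective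
  read_empty := rfl
  assoc a b c := by
    apply dSKcol_read_injective
    simp only [SDSData.starLeft, dSKcol_read_insWordLeft, List.append_assoc]

/-! ### Skew fillings and elementary slidings -/

/-- The entries of `T` weakly increase towards the south-east, and strictly if the row changes. -/
def Ordered (T : Filling n) : Prop :=
  ∀ p q x y, p ≤ q → T p = some x → T q = some y → x ≤ y ∧ (p.1 < q.1 → x < y)

/-- The set of the nonempty boxes. -/
def boxes (T : Filling n) : Set (ℕ × ℕ) := {b | T b ≠ none}

/-- Semistandard fillings of skew shapes inside the square of size `N`. That the shape is skew means
that it is order convex. -/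
structure IsSkewFilling (N : ℕ) (T : Filling n) : Prop where
  ordered : Ordered T
  convex : (boxes T).OrdConnected
  bounded : ∀ b, T b ≠ none → b.1 < N ∧ b.2 < N

/-- The fillings that occur during a forward sliding: a semistandard filling of a skew shape with an
empty box `b` in it. -/
structure IsHoledFilling (N : ℕ) (T : Filling n) (b : ℕ × ℕ) : Prop where
  hole : T b = none
  hole_bounded : b.1 < N ∧ b.2 < N
  ordered : Ordered T
  convex : (insert b (boxes T)).OrdConnected
  bounded : ∀ b, T b ≠ none → b.1 < N ∧ b.2 < N

theorem moveBox_apply (T : Filling n) (b' b c : ℕ × ℕ) :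
    moveBox T b' b c = if c = b' then none else if c = b then T b' else T c := by
  simp [moveBox, Function.update_apply]

/-- Boxes other than the hole between two boxes of the shape are nonempty. -/
theorem IsHoledFilling.ne_none {N : ℕ} {T : Filling n} {b p q r : ℕ × ℕ}
    (h : IsHoledFilling N T b) (hp : p = b ∨ T p ≠ none) (hq : q = b ∨ T q ≠ none) (hpr : p ≤ r)
    (hrq : r ≤ q) (hr : r ≠ b) : ∃ x, T r = some x :=
  Option.ne_none_iff_exists'.1 ((h.convex.out hp hq ⟨hpr, hrq⟩).resolve_left hr)

theorem IsSkewFilling.isHoledFilling {N : ℕ} {T : Filling n} {b : ℕ × ℕ} (h : IsSkewFilling N T)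
    (hb : IsInnerCorner T b) : IsHoledFilling N T b := by
  obtain ⟨⟨hb0, c, hc1, hc2, hc⟩, hdown, hright⟩ := hb
  have hNc := h.bounded c hc
  refine ⟨hb0, ⟨by omega, by omega⟩, h.ordered, ⟨?_⟩, h.bounded⟩
  rintro p hp q hq r ⟨hpr, hrq⟩
  by_cases hrb : r = b
  · exact Or.inl hrb
  refine Or.inr ?_
  rcases hq with rfl | hq
  · rcases hp with rfl | hp
    · exact absurd (le_antisymm hrq hpr) hrb
    · exact absurd hb0 (h.convex.out hp hc ⟨hpr.trans hrq, hc1, hc2⟩)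
  rcases hp with rfl | hp
  · have hcase : p.1 + 1 ≤ r.1 ∨ p.2 + 1 ≤ r.2 := by
      by_contra hcon
      push Not at hcon
      exact hrb (Prod.ext (by have := hpr.1; omega) (by have := hpr.2; omega))
    rcases hcase with h1 | h1
    · have : T (p.1 + 1, p.2) ≠ none := fun hn =>
        hdown ⟨hn, q, h1.trans hrq.1, hpr.2.trans hrq.2, hq⟩
      exact h.convex.out this hq ⟨⟨h1, hpr.2⟩, hrq⟩
    · have : T (p.1, p.2 + 1) ≠ none := fun hn =>
        hright ⟨hn, q, hpr.1.trans hrq.1, h1.trans hrq.2, hq⟩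
      exact h.convex.out this hq ⟨⟨hpr.1, h1⟩, hrq⟩
  · exact h.convex.out hp hq ⟨hpr, hrq⟩

theorem IsHoledFilling.isSkewFilling {N : ℕ} {T : Filling n} {b : ℕ × ℕ}
    (h : IsHoledFilling N T b) (hdown : T (b.1 + 1, b.2) = none)
    (hright : T (b.1, b.2 + 1) = none) : IsSkewFilling N T := by
  refine ⟨h.ordered, ⟨?_⟩, h.bounded⟩
  rintro p hp q hq r ⟨hpr, hrq⟩
  rcases h.convex.out (Or.inr hp) (Or.inr hq) ⟨hpr, hrq⟩ with rfl | hr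
  · have hcase : r.1 + 1 ≤ q.1 ∨ r.2 + 1 ≤ q.2 := by
      by_contra hcon
      push Not at hcon
      have : r = q := Prod.ext (by have := hrq.1; omega) (by have := hrq.2; omega)
      exact hq (this ▸ h.hole)
    rcases hcase with h1 | h1
    · obtain ⟨x, hx⟩ := h.ne_none (r := (r.1 + 1, r.2)) (Or.inl rfl) (Or.inr hq)
        ⟨Nat.le_succ _, le_rfl⟩ ⟨h1, hrq.2⟩ (by simp [Prod.ext_iff])
      rw [hdown] at hx
      cases hx
    · obtain ⟨x, hx⟩ := h.ne_none (r := (r.1, r.2 + 1)) (Or.inl rfl) (Or.inr hq)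
        ⟨le_rfl, Nat.le_succ _⟩ ⟨hrq.1, h1⟩ (by simp [Prod.ext_iff])
      rw [hright] at hx
      cases hx
  · exact hr

/-- The shape together with the hole does not change during a sliding. -/
theorem insert_boxes_moveBox {T : Filling n} {b b' : ℕ × ℕ} (hb' : T b' ≠ none) :
    insert b' (boxes (moveBox T b' b)) = insert b (boxes T) := by
  ext c
  simp only [Set.mem_insert_iff, boxes, Set.mem_ofPred_eq, moveBox_apply]
  by_cases h1 : c = b'
  · subst h1
    simp [hb']
  · by_cases h2 : c = b <;> simp [h1, h2, hb', em]

/-- It is enough to compare the entry that moves with the boxes around its new position. -/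
theorem ordered_moveBox {T : Filling n} {b b' : ℕ × ℕ} {x : Fin n} (hT : Ordered T)
    (hge : ∀ q y, b ≤ q → q ≠ b → q ≠ b' → T q = some y → x ≤ y ∧ (b.1 < q.1 → x < y))
    (hle : ∀ p y, p ≤ b → T p = some y → y ≤ x ∧ (p.1 < b.1 → y < x)) (hb' : T b' = some x) :
    Ordered (moveBox T b' b) := by
  intro p q y z hpq hp hq
  rw [moveBox_apply] at hp hq
  split_ifs at hp hq with h1 h2 h3 h4 h5 h6
  · subst h2 h4
    rw [hp] at hq
    cases hq
    exact ⟨le_rfl, fun h => absurd h (lt_irrefl _)⟩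
  · subst h2
    rw [hb'] at hp
    cases hp
    exact hge q z hpq h4 h3 hq
  · subst h6
    rw [hb'] at hq
    cases hq
    exact hle p y hpq hp
  · exact hT p q y z hpq hp hq

theorem SlideStep.isHoledFilling {N : ℕ} {s s' : Filling n × (ℕ × ℕ)} (h : SlideStep s s')
    (hs : IsHoledFilling N s.1 s.2) : IsHoledFilling N s'.1 s'.2 := by
  have key : ∀ (T : Filling n) (b b' : ℕ × ℕ) (x : Fin n), IsHoledFilling N T b → T b' = some x →
      Ordered (moveBox T b' b) → IsHoledFilling N (moveBox T b' b) b' := by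
    intro T b b' x hT hx ho
    have hb' : T b' ≠ none := by simp [hx]
    refine ⟨by simp [moveBox_apply], hT.bounded _ hb', ho, ?_, ?_⟩
    · rw [insert_boxes_moveBox hb']
      exact hT.convex
    · intro c hc
      rw [moveBox_apply] at hc
      split_ifs at hc with h1 h2
      · exact absurd rfl hc
      · exact h2 ▸ hT.hole_bounded
      · exact hT.bounded _ hc
  cases h with
  | up T i j x hx hy =>
    refine key T _ _ x hs hx (ordered_moveBox hs.ordered ?_ ?_ hx)
    · intro q y hbq hqb hqb' hq
      have h1 := hbq.1
      have h2 := hbq.2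
      simp only at h1 h2
      rcases h2.eq_or_lt with h2 | h2
      · have h3 : i + 1 ≤ q.1 := by
          rcases h1.eq_or_lt with h1 | h1
          · exact absurd (Prod.ext h1.symm h2.symm) hqb
          · exact h1
        have h4 : i + 1 < q.1 := by
          rcases h3.eq_or_lt with h3 | h3
          · exact absurd (Prod.ext h3.symm h2.symm) hqb'
          · exact h3
        have := (hs.ordered _ q x y ⟨h3, h2.le⟩ hx hq).2 h4
        exact ⟨this.le, fun _ => this⟩
      · obtain ⟨z, hz⟩ := hs.ne_none (r := (i, j + 1)) (Or.inl rfl)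
          (Or.inr (show T q ≠ none by simp [hq])) ⟨le_rfl, Nat.le_succ _⟩ ⟨h1, h2⟩ (by simp)
        have h3 := hs.ordered (i, j + 1) q z y ⟨h1, h2⟩ hz hq
        exact ⟨(hy z hz).trans h3.1, fun h => (hy z hz).trans_lt (h3.2 h)⟩
    · intro p y hpb hp
      have := (hs.ordered p (i + 1, j) y x ⟨hpb.1.trans (Nat.le_succ _), hpb.2⟩ hp hx).2
        (Nat.lt_succ_of_le hpb.1)
      exact ⟨this.le, fun _ => this⟩
  | left T i j x hx hy =>
    refine key T _ _ x hs hx (ordered_moveBox hs.ordered ?_ ?_ hx)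
    · intro q y hbq hqb hqb' hq
      have h1 := hbq.1
      have h2 := hbq.2
      simp only at h1 h2
      rcases h2.eq_or_lt with h2 | h2
      · have h3 : i + 1 ≤ q.1 := by
          rcases h1.eq_or_lt with h1 | h1
          · exact absurd (Prod.ext h1.symm h2.symm) hqb
          · exact h1
        obtain ⟨z, hz⟩ := hs.ne_none (r := (i + 1, j)) (Or.inl rfl)
          (Or.inr (show T q ≠ none by simp [hq])) ⟨Nat.le_succ _, le_rfl⟩ ⟨h3, h2.le⟩ (by simp)
        have h4 := (hs.ordered (i + 1, j) q z y ⟨h3, h2.le⟩ hz hq).1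
        have := (hy z hz).trans_le h4
        exact ⟨this.le, fun _ => this⟩
      · exact hs.ordered (i, j + 1) q x y ⟨h1, h2⟩ hx hq
    · intro p y hpb hp
      exact hs.ordered p (i, j + 1) y x ⟨hpb.1, hpb.2.trans (Nat.le_succ _)⟩ hp hx

/-! ### The reading of a filling during a sliding -/

/-- The entries of column `j` of a filling, from top to bottom. -/
def column (N : ℕ) (T : Filling n) (j : ℕ) : List (Fin n) := colSeg (fun i => T (i, j)) 0 N

theorem readFilling_eq (N : ℕ) (T : Filling n) :
    readFilling N T = (List.range' 0 N).flatMap fun j => (column N T j).reverse := by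
  unfold readFilling column colSeg
  simp only [List.filterMap_reverse, List.range_eq_range']

theorem readFilling_eq_append {N j m : ℕ} (h : j + (2 + m) = N) (T : Filling n) :
    readFilling N T = ((List.range' 0 j).flatMap fun j => (column N T j).reverse) ++
      ((column N T j).reverse ++ (column N T (j + 1)).reverse) ++
      (List.range' (j + 2) m).flatMap fun j => (column N T j).reverse := by
  have : List.range' 0 N = List.range' 0 j ++ ([j, j + 1] ++ List.range' (j + 2) m) := by
    rw [← h, ← List.range'_append_1, ← List.range'_append_1]
    simp [List.range'_succ]
  rw [readFilling_eq, this]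
  simp

theorem column_eq_append {N i m : ℕ} (h : i + (1 + m) = N) (T : Filling n) (j : ℕ) :
    column N T j = colSeg (fun r => T (r, j)) 0 i ++ (T (i, j)).toList ++
      colSeg (fun r => T (r, j)) (i + 1) m := by
  unfold column
  rw [← h, colSeg_add, colSeg_add, colSeg_succ]
  simp [colSeg_zero]

theorem column_congr {N : ℕ} {T T' : Filling n} {j : ℕ} (h : ∀ i, T (i, j) = T' (i, j)) :
    column N T j = column N T' j := colSeg_congr fun r _ _ => h r

theorem SlideStep.placticEq {N : ℕ} {s s' : Filling n × (ℕ × ℕ)} (h : SlideStep s s')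
    (hs : IsHoledFilling N s.1 s.2) : PlacticEq (readFilling N s.1) (readFilling N s'.1) := by
  cases h with
  | up T i j x hx hy =>
    -- a vertical sliding does not change the readings of the columns
    obtain ⟨m, hm⟩ := Nat.exists_eq_add_of_le
      (show i + 2 ≤ N from (hs.bounded (i + 1, j) (by simp [hx])).1)
    have hcol : ∀ j', column N T j' = column N (moveBox T (i + 1, j) (i, j)) j' := by
      intro j'
      by_cases hj : j' = j
      · subst hj
        have hsplit : ∀ S : Filling n, column N S j' = colSeg (fun r => S (r, j')) 0 i ++
            (S (i, j')).toList ++ ((S (i + 1, j')).toList ++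
              colSeg (fun r => S (r, j')) (i + 2) m) := by
          intro S
          rw [column_eq_append (i := i) (m := m + 1) (by omega), colSeg_succ]
        have hi : T (i, j') = none := hs.hole
        rw [hsplit, hsplit, colSeg_congr (f := fun r => moveBox T (i + 1, j') (i, j') (r, j'))
            (g := fun r => T (r, j')),
          colSeg_congr (f := fun r => moveBox T (i + 1, j') (i, j') (r, j')) (k := i + 2)
            (g := fun r => T (r, j'))]
        · simp [moveBox_apply, hi, hx]
        · intro r h1 h2
          have e1 : r ≠ i := by omega
          have e2 : r ≠ i + 1 := by omega
          simp [moveBox_apply, e1, e2]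
        · intro r h1 h2
          have e1 : r ≠ i := by omega
          have e2 : r ≠ i + 1 := by omega
          simp [moveBox_apply, e1, e2]
      · exact column_congr fun r => by simp [moveBox_apply, hj]
    rw [readFilling_eq, readFilling_eq]
    simp only [hcol]
    exact PlacticEq.refl _
  | left T i j x hx hy =>
    have hbd := hs.bounded (i, j + 1) (by simp [hx])
    obtain ⟨m, hm⟩ := Nat.exists_eq_add_of_le (show j + 2 ≤ N from hbd.2)
    obtain ⟨l, hl⟩ := Nat.exists_eq_add_of_le (show i + 1 ≤ N from hbd.1)
    have hi : T (i, j) = none := hs.hole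
    rw [readFilling_eq_append (j := j) (m := m) (by omega),
      readFilling_eq_append (j := j) (m := m) (by omega)]
    refine PlacticEq.append (PlacticEq.append (PlacticEq.flatMap fun j' hj' => ?_) ?_)
      (PlacticEq.flatMap fun j' hj' => ?_)
    · rw [List.mem_range'_1] at hj'
      have e1 : j' ≠ j := by omega
      have e2 : j' ≠ j + 1 := by omega
      exact PlacticEq.of_eq (congrArg _ (column_congr fun r => by simp [moveBox_apply, e1, e2]))
    -- away from row `i` the columns `j` and `j + 1` do not change
    · have hf : ∀ k m', (∀ r, k ≤ r → r < k + m' → r ≠ i) →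
          colSeg (fun r => moveBox T (i, j + 1) (i, j) (r, j)) k m' =
            colSeg (fun r => T (r, j)) k m' := fun k m' hr =>
        colSeg_congr fun r h1 h2 => by simp [moveBox_apply, hr r h1 h2]
      have hg : ∀ k m', (∀ r, k ≤ r → r < k + m' → r ≠ i) →
          colSeg (fun r => moveBox T (i, j + 1) (i, j) (r, j + 1)) k m' =
            colSeg (fun r => T (r, j + 1)) k m' := fun k m' hr =>
        colSeg_congr fun r h1 h2 => by simp [moveBox_apply, hr r h1 h2]
      rw [column_eq_append (i := i) (m := l) (by omega), column_eq_append (i := i) (m := l)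
        (by omega), column_eq_append (i := i) (m := l) (by omega),
        column_eq_append (i := i) (m := l) (by omega), hf 0 i (by omega),
        hf (i + 1) l (by omega), hg 0 i (by omega), hg (i + 1) l (by omega)]
      have hcol : ∀ j' r r' a b, r < r' → T (r, j') = some a → T (r', j') = some b → a < b :=
        fun j' r r' a b hrr' ha hb => (hs.ordered (r, j') (r', j') a b ⟨hrr'.le, le_rfl⟩ ha hb).2
          hrr'
      have hdom : Dom (· ≤ ·) (colSeg (fun r => T (r, j)) (i + 1) l)
          (colSeg (fun r => T (r, j + 1)) (i + 1) l) := by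
        refine dom_colSeg (fun r hr hn => ?_) (fun r y hr _ hy => ?_)
        · by_contra hne
          obtain ⟨z, hz⟩ := hs.ne_none (r := (r, j + 1))
            (Or.inr (show T (i, j + 1) ≠ none by simp [hx]))
            (Or.inr hne) ⟨by simp only; omega, le_rfl⟩ ⟨Nat.le_succ _, le_rfl⟩ (by simp)
          exact absurd (hn.symm.trans hz) (by simp)
        · obtain ⟨z, hz⟩ := hs.ne_none (r := (r, j)) (q := (r, j + 1)) (Or.inl rfl)
            (Or.inr (show T (r, j + 1) ≠ none from ne_of_eq_of_ne hy (by simp)))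
            ⟨by simp only; omega, le_rfl⟩ ⟨le_rfl, Nat.le_succ _⟩
            (by simp only [ne_eq, Prod.mk.injEq, and_true]; omega)
          exact ⟨z, hz, (hs.ordered (r, j) (r, j + 1) z y ⟨le_rfl, Nat.le_succ _⟩ hz hy).1⟩
      have := plactic_slide_columns (x := x) hdom
        (pairwise_colSeg fun r s a b _ hrs _ => hcol j r s a b hrs)
        (pairwise_colSeg fun r s a b _ hrs _ => hcol (j + 1) r s a b hrs)
        (fun y hy' => by
          obtain ⟨r, h1, -, h3⟩ := mem_colSeg.1 (List.mem_of_head? hy')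
          obtain ⟨z, hz⟩ := hs.ne_none (r := (i + 1, j)) (q := (r, j)) (Or.inl rfl)
            (Or.inr (show T (r, j) ≠ none by simp [h3])) ⟨Nat.le_succ _, le_rfl⟩ ⟨h1, le_rfl⟩
            (by simp)
          exact (hy z hz).trans_le (hs.ordered (i + 1, j) (r, j) z y ⟨h1, le_rfl⟩ hz h3).1)
        (fun y hy' => by
          obtain ⟨r, h1, -, h3⟩ := mem_colSeg.1 hy'
          exact hcol (j + 1) i r x y (by omega) hx h3)
        (f := fun r => T (r, j)) (g := fun r => T (r, j + 1)) (k := 0) (m := i)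
        (fun r a _ hr ha => by
          obtain ⟨z, hz⟩ := hs.ne_none (p := (r, j)) (r := (r, j + 1)) (q := (i, j + 1))
            (Or.inr (show T (r, j) ≠ none by simp [ha])) (Or.inr (show T _ ≠ none by simp [hx]))
            ⟨le_rfl, Nat.le_succ _⟩ ⟨by simp only; omega, le_rfl⟩ (by simp)
          exact ⟨z, hz, (hs.ordered (r, j) (r, j + 1) a z ⟨le_rfl, Nat.le_succ _⟩ ha hz).1⟩)
        (fun r a _ hr ha => hcol (j + 1) r i a x (by omega) ha hx)
        (fun r s a b _ hrs _ => hcol (j + 1) r s a b hrs)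
      simpa [moveBox_apply, hi, hx] using this
    · rw [List.mem_range'_1] at hj'
      have e1 : j' ≠ j := by omega
      have e2 : j' ≠ j + 1 := by omega
      exact PlacticEq.of_eq (congrArg _ (column_congr fun r => by simp [moveBox_apply, e1, e2]))

/-! ### Termination of the jeu de taquin -/

/-- The sum of the coordinates of the nonempty boxes, which decreases in each elementary sliding. -/
def weight (N : ℕ) (T : Filling n) : ℕ :=
  ∑ b ∈ Finset.range N ×ˢ Finset.range N, if T b = none then 0 else b.1 + b.2

theorem weight_moveBox {N : ℕ} {T : Filling n} {b b' : ℕ × ℕ} (hbN : b.1 < N ∧ b.2 < N)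
    (hbN' : b'.1 < N ∧ b'.2 < N) (hb : T b = none) (hb' : T b' ≠ none) :
    weight N (moveBox T b' b) + (b'.1 + b'.2) = weight N T + (b.1 + b.2) := by
  have hne : b ≠ b' := by
    rintro rfl
    exact hb' hb
  have hsum : ∀ c : ℕ × ℕ, c.1 < N ∧ c.2 < N →
      ∑ e ∈ Finset.range N ×ˢ Finset.range N, (if e = c then c.1 + c.2 else 0) = c.1 + c.2 := by
    intro c hc
    rw [Finset.sum_ite_eq' _ c fun _ => c.1 + c.2, if_pos (by simpa using hc)]
  unfold weight
  conv_lhs => rw [← hsum b' hbN']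
  conv_rhs => rw [← hsum b hbN]
  rw [← Finset.sum_add_distrib, ← Finset.sum_add_distrib]
  refine Finset.sum_congr rfl fun e _ => ?_
  rw [moveBox_apply]
  by_cases h1 : e = b'
  · subst h1
    simp [hb', hne.symm]
  · by_cases h2 : e = b
    · subst h2
      simp [hb, hb', h1]
    · simp [h1, h2]

theorem SlideStep.weight_lt {N : ℕ} {s s' : Filling n × (ℕ × ℕ)} (h : SlideStep s s')
    (hs : IsHoledFilling N s.1 s.2) : weight N s'.1 < weight N s.1 := by
  cases h with
  | up T i j x hx hy =>
    have hne : T (i + 1, j) ≠ none := by simp [hx]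
    have := weight_moveBox hs.hole_bounded (hs.bounded _ hne) hs.hole hne
    simp only at this ⊢
    omega
  | left T i j x hx hy =>
    have hne : T (i, j + 1) ≠ none := by simp [hx]
    have := weight_moveBox hs.hole_bounded (hs.bounded _ hne) hs.hole hne
    simp only at this ⊢
    omega

theorem exists_slideStep {T : Filling n} {b : ℕ × ℕ}
    (h : ¬(T (b.1 + 1, b.2) = none ∧ T (b.1, b.2 + 1) = none)) : ∃ s, SlideStep (T, b) s := by
  obtain ⟨i, j⟩ := b
  simp only at h
  cases hd : T (i + 1, j) with
  | none =>
    cases hr : T (i, j + 1) with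
    | none => exact absurd ⟨hd, hr⟩ h
    | some y => exact ⟨_, SlideStep.left T i j y hr (by simp [hd])⟩
  | some x =>
    cases hr : T (i, j + 1) with
    | none => exact ⟨_, SlideStep.up T i j x hd (by simp [hr])⟩
    | some y =>
      rcases le_or_gt x y with hxy | hxy
      · exact ⟨_, SlideStep.up T i j x hd (by simpa [hr] using hxy)⟩
      · exact ⟨_, SlideStep.left T i j y hr (by simpa [hd] using hxy)⟩

theorem exists_sliding_path {N : ℕ} {T : Filling n} {b : ℕ × ℕ} (h : IsHoledFilling N T b) :
    ∃ T' b', Relation.ReflTransGen SlideStep (T, b) (T', b') ∧ T' (b'.1 + 1, b'.2) = none ∧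
      T' (b'.1, b'.2 + 1) = none := by
  induction hw : weight N T using Nat.strong_induction_on generalizing T b with
  | _ w ih =>
    by_cases hend : T (b.1 + 1, b.2) = none ∧ T (b.1, b.2 + 1) = none
    · exact ⟨T, b, Relation.ReflTransGen.refl, hend⟩
    · obtain ⟨⟨S, c⟩, hs⟩ := exists_slideStep hend
      obtain ⟨T', b', h1, h2⟩ := ih _ (hw ▸ hs.weight_lt h) (hs.isHoledFilling h) rfl
      exact ⟨T', b', Relation.ReflTransGen.head hs h1, h2⟩

theorem IsHoledFilling.sliding_path {N : ℕ} {s s' : Filling n × (ℕ × ℕ)}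
    (h : Relation.ReflTransGen SlideStep s s') (hs : IsHoledFilling N s.1 s.2) :
    IsHoledFilling N s'.1 s'.2 ∧ PlacticEq (readFilling N s.1) (readFilling N s'.1) ∧
      weight N s'.1 ≤ weight N s.1 := by
  induction h with
  | refl => exact ⟨hs, PlacticEq.refl _, le_rfl⟩
  | tail _ hstep ih =>
    exact ⟨hstep.isHoledFilling ih.1, ih.2.1.trans (hstep.placticEq ih.1),
      (hstep.weight_lt ih.1).le.trans ih.2.2⟩

/-- The entry below or to the right of an inner corner exists. -/
theorem IsInnerCorner.not_end {T : Filling n} {b : ℕ × ℕ} (hb : IsInnerCorner T b) :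
    ¬(T (b.1 + 1, b.2) = none ∧ T (b.1, b.2 + 1) = none) := by
  rintro ⟨h1, h2⟩
  obtain ⟨⟨hb0, c, hc1, hc2, hc⟩, hdown, hright⟩ := hb
  rcases hc1.eq_or_lt with hc1 | hc1
  · rcases hc2.eq_or_lt with hc2 | hc2
    · exact hc ((Prod.ext hc1 hc2 : b = c) ▸ hb0)
    · exact hright ⟨h2, c, hc1.le, hc2, hc⟩
  · exact hdown ⟨h1, c, hc1, hc2, hc⟩

theorem ForwardSlide.preserves {N : ℕ} {T T' : Filling n} (h : ForwardSlide T T')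
    (hT : IsSkewFilling N T) : IsSkewFilling N T' ∧
      PlacticEq (readFilling N T) (readFilling N T') ∧ weight N T' < weight N T := by
  obtain ⟨b, b', hb, hpath, hdown, hright⟩ := h
  have hhole := hT.isHoledFilling hb
  obtain ⟨h1, h2, -⟩ := IsHoledFilling.sliding_path hpath hhole
  refine ⟨h1.isSkewFilling hdown hright, h2, ?_⟩
  rcases hpath.cases_head with heq | ⟨s, hs, hpath'⟩
  · cases heq
    exact absurd ⟨hdown, hright⟩ hb.not_end
  · exact (IsHoledFilling.sliding_path hpath' (hs.isHoledFilling hhole)).2.2.trans_lt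
      (hs.weight_lt hhole)

theorem IsSkewFilling.reflTransGen {N : ℕ} {T T' : Filling n} (hT : IsSkewFilling N T)
    (h : Relation.ReflTransGen ForwardSlide T T') :
    IsSkewFilling N T' ∧ PlacticEq (readFilling N T) (readFilling N T') := by
  induction h with
  | refl => exact ⟨hT, PlacticEq.refl _⟩
  | tail _ hstep ih =>
    obtain ⟨h1, h2, -⟩ := hstep.preserves ih.1
    exact ⟨h1, ih.2.trans h2⟩

theorem IsSkewFilling.acc {N : ℕ} {T : Filling n} (hT : IsSkewFilling N T) :
    Acc (fun T' T : Filling n => ForwardSlide T T') T := by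
  induction hw : weight N T using Nat.strong_induction_on generalizing T with
  | _ w ih =>
    refine Acc.intro _ fun T' h => ?_
    obtain ⟨h1, -, h3⟩ := h.preserves hT
    exact ih _ (hw ▸ h3) h1 rfl

theorem IsSkewFilling.exists_isRectification {N : ℕ} {T : Filling n} (hT : IsSkewFilling N T) :
    ∃ T', IsRectification T T' := by
  induction hw : weight N T using Nat.strong_induction_on generalizing T with
  | _ w ih =>
    by_cases hcorner : ∃ b, IsInnerCorner T b
    · obtain ⟨b, hb⟩ := hcorner
      obtain ⟨S, b', h1, h2, h3⟩ := exists_sliding_path (hT.isHoledFilling hb)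
      have hS : ForwardSlide T S := ⟨b, b', hb, h1, h2, h3⟩
      obtain ⟨h4, -, h5⟩ := hS.preserves hT
      obtain ⟨T', h6, h7⟩ := ih _ (hw ▸ h5) h4 rfl
      exact ⟨T', Relation.ReflTransGen.head hS h6, h7⟩
    · exact ⟨T, Relation.ReflTransGen.refl, fun b hb => hcorner ⟨b, hb⟩⟩

/-- A skew filling without inner corner has no inner box either: its shape is a partition. -/
theorem IsSkewFilling.not_isInnerBox {N : ℕ} {T : Filling n} (hT : IsSkewFilling N T)
    (h : ∀ b, ¬ IsInnerCorner T b) (b : ℕ × ℕ) : ¬ IsInnerBox T b := by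
  induction hk : 2 * N - (b.1 + b.2) using Nat.strong_induction_on generalizing b with
  | _ k ih =>
    intro hb
    obtain ⟨c, h1, h2, h3⟩ := hb.2
    have hc := hT.bounded c h3
    exact h b ⟨hb, ih _ (by omega) (b.1 + 1, b.2) rfl, ih _ (by omega) (b.1, b.2 + 1) rfl⟩

/-! ### The fillings of tableaux -/

theorem colSeg_eq {α : Type*} {f : ℕ → Option α} {u : List α} {k : ℕ}
    (h : ∀ i < u.length, f (k + i) = u[i]?) : colSeg f k u.length = u := by
  induction u generalizing k with
  | nil => rfl
  | cons a u ih =>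
    have h0 := h 0 (by simp)
    rw [Nat.add_zero] at h0
    rw [List.length_cons, colSeg_succ, h0, ih fun i hi => ?_]
    · rfl
    · have := h (i + 1) (by simpa using hi)
      rwa [List.getElem?_cons_succ, ← Nat.add_assoc, Nat.add_right_comm] at this

theorem colSeg_getElem? {α : Type*} {f : ℕ → Option α} {k m : ℕ}
    (hf : ∀ r, k ≤ r → f r = none → f (r + 1) = none) (hb : ∀ r, k + m ≤ r → f r = none) (i : ℕ) :
    (colSeg f k m)[i]? = f (k + i) := by
  induction m generalizing k i with
  | zero => rw [colSeg_zero, hb (k + i) (by omega)]; rfl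
  | succ m ih =>
    have ih' := ih (k := k + 1) (fun r hr => hf r (by omega)) (fun r hr => hb r (by omega))
    rw [colSeg_succ]
    cases hk : f k with
    | none =>
      have hnone : ∀ r, k ≤ r → f r = none := fun r hr => Nat.le_induction hk hf r hr
      rw [colSeg_eq_nil fun r hr _ => hnone r (by omega), hnone (k + i) (by omega)]
      rfl
    | some a =>
      cases i with
      | zero => simp [hk]
      | succ i =>
        have := ih' i
        rw [Nat.add_right_comm] at this
        simpa [Nat.add_assoc] using this

theorem filling_cons_zero (g : List (Fin n) → List (Fin n) → ℕ) (u : List (Fin n))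
    (w : List (List (Fin n))) (i : ℕ) : filling g (u :: w) (i, 0) =
      if topRow g (u :: w) ≤ i then u[i - topRow g (u :: w)]? else none := by
  rw [filling]

theorem filling_cons_succ (g : List (Fin n) → List (Fin n) → ℕ) (u : List (Fin n))
    (w : List (List (Fin n))) (i j : ℕ) : filling g (u :: w) (i, j + 1) = filling g w (i, j) := by
  rw [filling]

theorem exists_bound_filling (g : List (Fin n) → List (Fin n) → ℕ) (w : List (List (Fin n))) :
    ∃ N, ∀ b, filling g w b ≠ none → b.1 < N ∧ b.2 < N := by
  induction w with
  | nil => exact ⟨0, fun b hb => absurd (by rw [filling]) hb⟩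
  | cons u w ih =>
    obtain ⟨N, hN⟩ := ih
    refine ⟨N + 1 + (topRow g (u :: w) + u.length), ?_⟩
    rintro ⟨i, _ | j⟩ hb
    · rw [filling_cons_zero] at hb
      split_ifs at hb with h
      · have : i - topRow g (u :: w) < u.length := by
          by_contra hcon
          exact hb (List.getElem?_eq_none (not_lt.1 hcon))
        exact ⟨by simp only; omega, by simp only; omega⟩
      · exact absurd rfl hb
    · rw [filling_cons_succ] at hb
      have := hN _ hb
      exact ⟨by simp only at *; omega, by simp only at *; omega⟩

/-- The column index `k` of the first column of `w` is free, for the induction on `w`. -/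
theorem readSW_eq_of_filling {g : List (Fin n) → List (Fin n) → ℕ} {w : List (List (Fin n))}
    (hw : ∀ c ∈ w, c ≠ []) {N M k : ℕ} {T : Filling n}
    (hT : ∀ i j, T (i, k + j) = filling g w (i, j))
    (hb : ∀ b, filling g w b ≠ none → b.1 < N ∧ b.2 < M) :
    ((List.range' k M).flatMap fun j => (column N T j).reverse) = readSW w := by
  induction w generalizing M k with
  | nil =>
    simp only [readSW, List.flatMap_nil, List.flatMap_eq_nil_iff, List.reverse_eq_nil_iff]
    intro j hj
    rw [List.mem_range'_1] at hj
    refine colSeg_eq_nil fun r _ _ => ?_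
    have := hT r (j - k)
    rwa [Nat.add_sub_cancel' hj.1, filling] at this
  | cons u w ih =>
    have hu := List.length_pos_iff.2 (hw u (by simp))
    have hlast := hb (topRow g (u :: w) + (u.length - 1), 0) (by
      rw [filling_cons_zero, if_pos (by omega), Nat.add_sub_cancel_left,
        List.getElem?_eq_getElem (by omega)]
      simp)
    simp only at hlast
    obtain ⟨M, rfl⟩ := Nat.exists_eq_succ_of_ne_zero (show M ≠ 0 by omega)
    rw [List.range'_succ, List.flatMap_cons, readSW_cons]
    rw [ih (fun c hc => hw c (List.mem_cons_of_mem _ hc)) (k := k + 1) (M := M)]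
    · congr 2
      obtain ⟨l, hl⟩ := Nat.exists_eq_add_of_le
        (show topRow g (u :: w) + u.length ≤ N by omega)
      have hcol : ∀ r, T (r, k) =
          if topRow g (u :: w) ≤ r then u[r - topRow g (u :: w)]? else none := by
        intro r
        rw [← filling_cons_zero, ← hT, Nat.add_zero]
      unfold column
      rw [hl, colSeg_add, colSeg_add, colSeg_eq_nil, Nat.zero_add, colSeg_eq, colSeg_eq_nil]
      · simp
      · intro r h1 h2
        rw [hcol, if_pos (by omega), List.getElem?_eq_none (by omega)]
      · intro i hi
        rw [hcol, if_pos (by omega), Nat.add_sub_cancel_left]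
      · intro r h1 h2
        rw [hcol, if_neg (by omega)]
    · intro i j
      rw [← filling_cons_succ g u, ← hT, Nat.add_assoc, Nat.add_comm 1]
    · rintro ⟨i, j⟩ hij
      have := hb (i, j + 1) (by rwa [filling_cons_succ])
      exact ⟨this.1, by simpa using this.2⟩

theorem readFilling_filling {g : List (Fin n) → List (Fin n) → ℕ} {w : List (List (Fin n))}
    (hw : ∀ c ∈ w, c ≠ []) {N : ℕ} (hb : ∀ b, filling g w b ≠ none → b.1 < N ∧ b.2 < N) :
    readFilling N (filling g w) = readSW w := by
  rw [readFilling_eq]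
  exact readSW_eq_of_filling hw (k := 0) (fun i j => by rw [Nat.zero_add]) hb

/-- The bottom box of the first column is in the last row of a diagonal skew tableau. -/
theorem filling_diag_row_lt {c : List (Fin n)} {w : List (List (Fin n))}
    (hw : ∀ e ∈ c :: w, e ≠ []) {i j : ℕ} (h : filling diagGlue (c :: w) (i, j) ≠ none) :
    i < topRow diagGlue (c :: w) + c.length := by
  induction w generalizing c j with
  | nil =>
    cases j with
    | zero =>
      rw [filling_cons_zero] at h
      split_ifs at h with h'
      · by_contra hcon
        exact h (List.getElem?_eq_none (by omega))
      · exact absurd rfl h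
    | succ j => exact absurd (by rw [filling_cons_succ, filling]) h
  | cons d w ih =>
    cases j with
    | zero =>
      rw [filling_cons_zero] at h
      split_ifs at h with h'
      · by_contra hcon
        exact h (List.getElem?_eq_none (by omega))
      · exact absurd rfl h
    | succ j =>
      rw [filling_cons_succ] at h
      have h1 := ih (fun e he => hw e (List.mem_cons_of_mem _ he)) h
      have h2 := List.length_pos_iff.2 (hw c (by simp))
      have h3 : topRow diagGlue (c :: d :: w) = topRow diagGlue (d :: w) + (d.length - 1) := rfl
      omega

/-- A box in the first column of a diagonal skew tableau and a box in another column to the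
south-east of it lie both in the row of the gluing. -/
theorem filling_diag_glue {u c : List (Fin n)} {w : List (List (Fin n))}
    (hw : ∀ e ∈ u :: c :: w, e ≠ []) {i i' j : ℕ}
    (hp : filling diagGlue (u :: c :: w) (i, 0) ≠ none)
    (hq : filling diagGlue (c :: w) (i', j) ≠ none) (hi : i ≤ i') :
    i = topRow diagGlue (u :: c :: w) ∧ i' = i ∧
      filling diagGlue (u :: c :: w) (i, 0) = u.head? ∧
      filling diagGlue (c :: w) (i, 0) = c.getLast? := by
  have h1 := filling_diag_row_lt (fun e he => hw e (List.mem_cons_of_mem _ he)) hq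
  have h2 : topRow diagGlue (u :: c :: w) = topRow diagGlue (c :: w) + (c.length - 1) := rfl
  have h3 := List.length_pos_iff.2 (hw c (by simp))
  rw [filling_cons_zero] at hp
  split_ifs at hp with h
  · have hi1 : i = topRow diagGlue (u :: c :: w) := by omega
    refine ⟨hi1, by omega, ?_, ?_⟩
    · rw [filling_cons_zero, if_pos h, ← hi1, Nat.sub_self, List.head?_eq_getElem?]
    · rw [filling_cons_zero, if_pos (by omega), List.getLast?_eq_getElem?]
      congr 1
      omega
  · exact absurd rfl hp

theorem filling_diag_ordered_convex {w : List (List (Fin n))} (hw : IsTableau diagGlue w) :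
    Ordered (filling diagGlue w) ∧ (boxes (filling diagGlue w)).OrdConnected := by
  induction w with
  | nil =>
    have h0 : ∀ b, filling diagGlue ([] : List (List (Fin n))) b = none := fun b => by rw [filling]
    refine ⟨fun p q x y _ hp => ?_, ⟨fun p hp => absurd (h0 p) hp⟩⟩
    rw [h0] at hp
    cases hp
  | cons u w ih =>
    obtain ⟨h1, h2⟩ := hw
    obtain ⟨ih1, ih2⟩ := ih ⟨fun l hl => h1 l (List.mem_cons_of_mem _ hl), h2.tail⟩
    obtain ⟨hu0, hu⟩ := h1 u (by simp)
    set s := topRow diagGlue (u :: w) with hs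
    have hcol : ∀ {i x}, filling diagGlue (u :: w) (i, 0) = some x →
        s ≤ i ∧ u[i - s]? = some x := by
      intro i x hx
      rw [filling_cons_zero] at hx
      split_ifs at hx with h
      exact ⟨h, hx⟩
    constructor
    · rintro ⟨i, j⟩ ⟨i', j'⟩ x y ⟨hi, hj⟩ hp hq
      simp only at hi hj ⊢
      cases j with
      | zero =>
        cases j' with
        | zero =>
          obtain ⟨hsi, hx⟩ := hcol hp
          obtain ⟨hsi', hy⟩ := hcol hq
          obtain ⟨hlt, rfl⟩ := List.getElem?_eq_some_iff.1 hx
          obtain ⟨hlt', rfl⟩ := List.getElem?_eq_some_iff.1 hy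
          have key : i < i' → u[i - s] < u[i' - s] := fun h =>
            List.pairwise_iff_getElem.1 hu _ _ hlt hlt' (by omega)
          refine ⟨?_, key⟩
          rcases hi.eq_or_lt with rfl | hi
          · exact le_rfl
          · exact (key hi).le
        | succ j' =>
          rw [filling_cons_succ] at hq
          cases w with
          | nil => rw [filling] at hq; cases hq
          | cons c w =>
            obtain ⟨-, rfl, h3, h4⟩ := filling_diag_glue (j := j') (fun e he => (h1 e he).1)
              (by simp [hp]) (by simp [hq]) hi
            refine ⟨?_, fun h => absurd h (lt_irrefl _)⟩
            have hc0 := (h1 c (by simp)).1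
            have hg := (glued_diag_iff hu0 hc0).1 (List.isChain_cons_cons.1 h2).1
            rw [List.getLast?_eq_some_getLast hc0] at h4 hg
            have hx : x ≤ c.getLast hc0 := hg x (by rw [← h3, hp]; rfl) _ rfl
            exact hx.trans (ih1 (i', 0) (i', j') _ y ⟨le_rfl, Nat.zero_le _⟩ h4 hq).1
      | succ j =>
        obtain ⟨j', rfl⟩ := Nat.exists_eq_succ_of_ne_zero (show j' ≠ 0 by omega)
        rw [filling_cons_succ] at hp hq
        exact ih1 (i, j) (i', j') x y ⟨hi, by simpa using hj⟩ hp hq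
    · refine ⟨?_⟩
      rintro ⟨i, j⟩ hp ⟨i', j'⟩ hq ⟨r, k⟩ ⟨⟨hir, hjk⟩, ⟨hri, hkj⟩⟩
      simp only at hir hjk hri hkj
      simp only [boxes, Set.mem_ofPred_eq] at hp hq ⊢
      cases j with
      | zero =>
        cases j' with
        | zero =>
          obtain rfl : k = 0 := by omega
          obtain ⟨x, hx⟩ := Option.ne_none_iff_exists'.1 hp
          obtain ⟨y, hy⟩ := Option.ne_none_iff_exists'.1 hq
          obtain ⟨hsi, hx⟩ := hcol hx
          obtain ⟨hsi', hy⟩ := hcol hy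
          obtain ⟨hlt', -⟩ := List.getElem?_eq_some_iff.1 hy
          rw [filling_cons_zero, if_pos (by omega), List.getElem?_eq_getElem (by omega)]
          simp
        | succ j' =>
          rw [filling_cons_succ] at hq
          cases w with
          | nil => exact absurd (by rw [filling]) hq
          | cons c w =>
            obtain ⟨-, rfl, -, h4⟩ := filling_diag_glue (fun e he => (h1 e he).1) hp hq
              (hir.trans hri)
            obtain rfl : r = i' := by omega
            cases k with
            | zero => exact hp
            | succ k =>
              rw [filling_cons_succ]
              have hc0 := (h1 c (by simp)).1
              refine ih2.out (x := (r, 0)) ?_ hq ⟨⟨le_rfl, Nat.zero_le _⟩,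
                ⟨le_rfl, by simpa using hkj⟩⟩
              simp [boxes, h4, hc0]
      | succ j =>
        obtain ⟨j', rfl⟩ := Nat.exists_eq_succ_of_ne_zero (show j' ≠ 0 by omega)
        obtain ⟨k, rfl⟩ := Nat.exists_eq_succ_of_ne_zero (show k ≠ 0 by omega)
        rw [filling_cons_succ] at hp hq ⊢
        exact ih2.out hp hq ⟨⟨hir, by simpa using hjk⟩, ⟨hri, by simpa using hkj⟩⟩

theorem DSkew.exists_isSkewFilling (d : DSkew n) : ∃ N, IsSkewFilling N d.filling := by
  obtain ⟨N, hN⟩ := exists_bound_filling diagGlue d.1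
  obtain ⟨h1, h2⟩ := filling_diag_ordered_convex d.2
  exact ⟨N, h1, h2, hN⟩

theorem topRow_youngGlue (w : List (List (Fin n))) : topRow youngGlue w = 0 := by
  induction w with
  | nil => rfl
  | cons c w ih =>
    cases w with
    | nil => rfl
    | cons d w => simpa [topRow, youngGlue] using ih

/-- A semistandard filling of a partition is the filling of a Young tableau. -/
theorem exists_young_filling_eq {N M : ℕ} {T : Filling n} (ho : Ordered T)
    (hb : ∀ b, T b ≠ none → b.1 < N ∧ b.2 < M) (hdc : ∀ b c, b ≤ c → T c ≠ none → T b ≠ none) :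
    ∃ t : Young n, t.filling = T := by
  suffices h : ∃ t, IsLines (· < ·) (· ≤ ·) t ∧ filling youngGlue t = T by
    obtain ⟨t, h1, h2⟩ := h
    exact ⟨⟨t, isTableau_young_iff.2 h1⟩, h2⟩
  induction M generalizing T with
  | zero =>
    refine ⟨[], by simp [IsLines], funext fun b => ?_⟩
    rw [filling]
    by_contra h
    exact absurd (hb b fun h' => h h'.symm).2 (Nat.not_lt_zero _)
  | succ M ih =>
    by_cases h0 : T (0, 0) = none
    · refine ⟨[], by simp [IsLines], funext fun b => ?_⟩
      rw [filling]
      by_contra h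
      exact hdc (0, 0) b ⟨Nat.zero_le _, Nat.zero_le _⟩ (fun h' => h h'.symm) h0
    obtain ⟨t, ht, htT⟩ := ih (T := fun b => T (b.1, b.2 + 1))
      (fun p q x y hpq hp hq => ho (p.1, p.2 + 1) (q.1, q.2 + 1) x y
        ⟨hpq.1, Nat.succ_le_succ hpq.2⟩ hp hq)
      (fun b hb' => ⟨(hb _ hb').1, by simpa using (hb _ hb').2⟩)
      (fun b c hbc => hdc (b.1, b.2 + 1) (c.1, c.2 + 1) ⟨hbc.1, Nat.succ_le_succ hbc.2⟩)
    have hu : ∀ i, (column N T 0)[i]? = T (i, 0) := by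
      intro i
      unfold column
      rw [colSeg_getElem?, Nat.zero_add]
      · intro r _ hr
        by_contra hcon
        exact hdc (r, 0) (r + 1, 0) ⟨Nat.le_succ _, le_rfl⟩ hcon hr
      · intro r hr
        by_contra hcon
        have := (hb _ hcon).1
        simp only at this
        omega
    refine ⟨column N T 0 :: t, ⟨?_, ?_⟩, ?_⟩
    · intro l hl
      rcases List.mem_cons.1 hl with rfl | hl
      · refine ⟨fun hnil => h0 ?_, pairwise_colSeg fun r s x y _ hrs _ hx hy =>
          (ho (r, 0) (s, 0) x y ⟨hrs.le, le_rfl⟩ hx hy).2 hrs⟩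
        rw [← hu 0, hnil]
        rfl
      · exact ht.1 l hl
    · cases t with
      | nil => simp
      | cons v t =>
        refine List.isChain_cons_cons.2 ⟨?_, ht.2⟩
        have hv : ∀ i, v[i]? = T (i, 1) := by
          intro i
          have := congrFun htT (i, 0)
          rw [filling_cons_zero, topRow_youngGlue, if_pos (Nat.zero_le _), Nat.sub_zero] at this
          exact this
        refine dom_iff.2 ⟨?_, fun j x y hx hy => ?_⟩
        · by_contra hcon
          have h1 := hu (column N T 0).length
          have h2 := hv (column N T 0).length
          rw [List.getElem?_eq_none le_rfl] at h1
          rw [List.getElem?_eq_getElem (by omega)] at h2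
          exact hdc ((column N T 0).length, 0) (_, 1) ⟨le_rfl, Nat.zero_le _⟩
            (by rw [← h2]; simp) h1.symm
        · rw [hu] at hx
          rw [hv] at hy
          exact (ho (j, 0) (j, 1) x y ⟨le_rfl, Nat.zero_le _⟩ hx hy).1
    · funext b
      obtain ⟨i, _ | j⟩ := b
      · rw [filling_cons_zero, topRow_youngGlue, if_pos (Nat.zero_le _), Nat.sub_zero, hu]
      · rw [filling_cons_succ, htT]

/-! ### The rectification of diagonal skew tableaux -/

/-- The Young tableau of the reading of a diagonal skew tableau. -/
def rectification (d : DSkew n) : Young n := (Ycol n).constrLeft ((dSKcol n).read d)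

/-- Forward slidings preserve the plactic class of the reading, and a plactic class contains the
reading of one Young tableau only. -/
theorem IsRectification.eq_filling {d : DSkew n} {T : Filling n}
    (h : IsRectification d.filling T) : T = (rectification d).filling := by
  obtain ⟨N, hN⟩ := d.exists_isSkewFilling
  obtain ⟨h1, h2⟩ := hN.reflTransGen h.1
  obtain ⟨t, rfl⟩ := exists_young_filling_eq h1.ordered h1.bounded fun b c hbc hc hb =>
    h1.not_isInnerBox h.2 b ⟨hb, c, hbc.1, hbc.2, hc⟩
  have e1 : readFilling N d.filling = readSW d.1 :=
    readFilling_filling (fun c hc => (d.2.1 c hc).1) hN.bounded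
  have e2 : readFilling N t.filling = readSW t.1 :=
    readFilling_filling (fun c hc => (t.2.1 c hc).1) h1.bounded
  rw [e1, e2] at h2
  have e3 : (Ycol n).constrLeft (readSW t.1) = t := Ycol_constrLeft_read t
  have e4 : rectification d = t := (Ycol_constrLeft_congr h2).trans e3
  rw [e4]

theorem isRectification_iff (d : DSkew n) (T : Filling n) :
    IsRectification d.filling T ↔ T = (rectification d).filling := by
  refine ⟨IsRectification.eq_filling, fun h => ?_⟩
  obtain ⟨N, hN⟩ := d.exists_isSkewFilling
  obtain ⟨T', hT'⟩ := hN.exists_isRectification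
  rwa [h, ← hT'.eq_filling]

theorem rectification_surjective : Function.Surjective (rectification (n := n)) := by
  intro t
  refine ⟨(dSKrow n).constrRight ((Ycol n).read t), ?_⟩
  refine Eq.trans (congrArg (Ycol n).constrLeft ?_) (Ycol_constrLeft_read t)
  exact dSKrow_read_constrRight _

theorem isRightMorphism_rectification : IsRightMorphism (dSKrow n) (Yrow n) rectification where
  map_empty := rfl
  map_ins d x := by
    have h1 : (dSKcol n).read ((dSKrow n).ins d x) = (dSKrow n).read d ++ [x] :=
      dSKrow_read_insWordRight d [x]
    have h2 := Yrow_insWordRight_eq (rectification d) [x]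
    refine (congrArg (Ycol n).constrLeft h1).trans (Eq.trans ?_ h2.symm)
    exact Ycol_constrLeft_congr ((plactic_read_constrLeft _).append_right [x])
  constr_read _ := by
    rw [Yrow_constrRight_eq, Yrow_constrRight_eq]
    exact Ycol_constrLeft_congr (plactic_read_constrLeft _)

theorem isLeftMorphism_rectification : IsLeftMorphism (dSKcol n) (Ycol n) rectification where
  map_empty := rfl
  map_ins d x := congrArg (Ycol n).constrLeft (dSKcol_read_ins d x)
  constr_read _ := Ycol_constrLeft_congr (plactic_read_constrLeft _)

end JdT

theorem theoremT (n : ℕ) :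
    -- the four structures are (associative) string data structures
    (IsRightSDS (dSKrow n) ∧ IsRightSDS (Yrow n) ∧ IsLeftSDS (dSKcol n) ∧ IsLeftSDS (Ycol n)) ∧
    -- every word is the reading of a unique diagonal skew tableau
    Function.Bijective (dSKrow n).read ∧
    ∃ rect : DSkew n → Young n,
      -- `rect` is the rectification: the jeu de taquin terminates, and whatever the choices of
      -- inner corners are, it ends with `rect d`
      (∀ d : DSkew n, Acc (fun T' T => ForwardSlide T T') d.filling) ∧
      (∀ (d : DSkew n) (T : Filling n), IsRectification d.filling T ↔ T = (rect d).filling) ∧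
      -- it is a surjective morphism, for the right and for the left structures
      Function.Surjective rect ∧
      IsRightMorphism (dSKrow n) (Yrow n) rect ∧
      IsLeftMorphism (dSKcol n) (Ycol n) rect ∧
      -- it computes both constructors of Young tableaux
      (∀ d : DSkew n, rect d = (Yrow n).constrRight ((dSKrow n).read d) ∧
        rect d = (Ycol n).constrLeft ((dSKcol n).read d)) ∧
      -- every forward sliding preserves the plactic class of the reading
      (∀ (d : DSkew n) (T T' : Filling n) (N : ℕ),
        Relation.ReflTransGen ForwardSlide d.filling T → ForwardSlide T T' →
        (∀ i j, T (i, j) ≠ none → i < N ∧ j < N) →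
        PlacticEq (readFilling N T) (readFilling N T')) ∧
      -- plactic congruent words have the same rectification
      (∀ d d' : DSkew n, PlacticEq ((dSKrow n).read d) ((dSKrow n).read d') → rect d = rect d') := by
  refine ⟨⟨isRightSDS_dSKrow n, isRightSDS_Yrow n, isLeftSDS_dSKcol n, isLeftSDS_Ycol n⟩,
    dSKrow_read_bijective, rectification, fun d => ?_, isRectification_iff,
    rectification_surjective, isRightMorphism_rectification, isLeftMorphism_rectification,
    fun d => ⟨(Yrow_constrRight_eq _).symm, rfl⟩, fun d T T' N hT h hN => ?_,
    fun d d' h => Ycol_constrLeft_congr h⟩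
  · obtain ⟨N, hN⟩ := d.exists_isSkewFilling
    exact hN.acc
  · obtain ⟨M, hM⟩ := d.exists_isSkewFilling
    have hTM := (hM.reflTransGen hT).1
    exact (h.preserves ⟨hTM.ordered, hTM.convex, fun b hb => hN b.1 b.2 hb⟩).2.1
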